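/- Setting. Let $\mathcal X$ be a standard Borel input space, $\mathcal Y\subseteq\mathbb R$ a measurable label set, and let either $\mathcal Y=\{-1,1\}$ and $\ell(u,y)=(\max\{0,1-yu\})^2$ (squared hinge loss), or $\ell(u,y)=(u-y)^2$ (MSE loss). Let $\mathcal H$ be a class of measurable functions $h:\mathcal X\to\mathbb R$ with finite VC dimension $d$, meaning that $d$ is the largest size of a finite subset of $\mathcal X\times\mathbb R$ shattered by the subgraphs $\{(x,t):t<h(x)\}$, $h\in\mathcal H$ (for $\{-1,1\}$-valued classes this is the usual VC dimension). Suppose $0\le \ell(h(x),y)\le B$ and $|\ell(h(x),y)-\ell(h'(x),y)|\le G\,|h(x)-h'(x)|$ for all $h,h'\in\mathcal H$, $x\in\mathcal X$, $y\in\mathcal Y$. There are $n$ clients with probability distributions $\mathcal D_1,\dots,\mathcal D_n$ on $\mathcal X\times\mathcal Y$ and sample sizes $m_1,\dots,m_n$; put $\bar{\mathcal D}=\frac1n\sum_j\mathcal D_j$ and $m=m_1+\dots+m_n$. Fix a client $i$ with $m_i\ge 1$. The local data set $\mathcal S_i$ consists of $m_i$ i.i.d. points drawn from $\mathcal D_i$.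 The global data set $\bar{\mathcal S}$ consists of $m$ independent points whose laws average to $\bar{\mathcal D}$ (for instance $m$ i.i.d. points drawn from $\bar{\mathcal D}$ or, when all $m_j$ are equal, the union of the clients' independent i.i.d. local data sets); the dependence between $\bar{\mathcal S}$ and $\mathcal S_i$ is arbitrary. Write $\mathcal L_{\mathcal D}(h)=\mathbb E_{(x,y)\sim \mathcal D}\,\ell(h(x),y)$ for the true risk, $\hat{\mathcal L}_{\bar{\mathcal D}}$ and $\hat{\mathcal L}_{\mathcal D_i}$ for the empirical risks (averages of the loss) over $\bar{\mathcal S}$ and $\mathcal S_i$, $\|\bar{\mathcal D}-\mathcal D_i\|_1=\int|d\bar{\mathcal D}-d\mathcal D_i|$ for the $L^1$ distance of the densities, and $$\lambda_{\mathcal H}(\mathcal S_i)=\sup_{h,h'\in\mathcal H}\frac1{m_i}\sum_{(x,y)\in \mathcal S_i}|h(x)-h'(x)| .$$ Fix $\alpha_i\in[0,1]$ and $\delta\in(0,1)$. Let $\bar h^*\in\arg\min_{h\in\mathcal H}\hat{\mathcal L}_{\bar{\mathcal D}}(h)$, $\hat h^*_{loc,i}\in\arg\min_{h\in\mathcal H}\hat{\mathcal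 L}_{\mathcal D_i}(\alpha_i h+(1-\alpha_i)\bar h^*)$ (both chosen measurably as functions of the data) and $h_i^*\in\arg\min_{h\in\mathcal H}\mathcal L_{\mathcal D_i}(h)$, and let $h_{\alpha_i}=\alpha_i\hat h^*_{loc,i}+(1-\alpha_i)\bar h^*$. Theorem. There is a constant $C>0$ depending only on $B$ such that the following holds. Put $$a=\hat{\mathcal L}_{\bar{\mathcal D}}(\bar h^*)+B\|\bar{\mathcal D}-\mathcal D_i\|_1+C\sqrt{\frac{d+\log(1/\delta)}{m}},\qquad b=\mathcal L_{\mathcal D_i}(h_i^*)+2C\sqrt{\frac{d+\log(1/\delta)}{m_i}}+G\lambda_{\mathcal H}(\mathcal S_i).$$ Then, with probability at least $1-\delta$, $$\mathcal L_{\mathcal D_i}(h_{\alpha_i})\le 2(1-\alpha_i)^2\,a+2\alpha_i^2\,b .$$ Moreover, for every realization of the data, the right-hand side, as a quadratic function $\beta\mapsto 2(1-\beta)^2a+2\beta^2b$ of the mixing weight $\beta$ (with $a$, $b$ held fixed), has the unique minimizer $\alpha_i^*=a/(a+b)$, and $0<\alpha_i^*<1$. -/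

import Mathlib

open MeasureTheory ProbabilityTheory
open scoped ENNReal

universe u v

noncomputable section

namespace FedMix

/-- Squared hinge loss `(max {0, 1 - y u})²` of the prediction `u` at the label `y`. -/
def sqHinge (u y : ℝ) : ℝ := (max 0 (1 - y * u)) ^ 2

/-- Squared error (MSE) loss `(u - y)²` of the prediction `u` at the label `y`. -/
def sqError (u y : ℝ) : ℝ := (u - y) ^ 2

/-- The finite set `s` is shattered by the family `𝒜`: every subset of `s` is cut out of `s` by
a member of `𝒜`. -/
def Shatters {α : Type*} (𝒜 : Set (Set α)) (s : Finset α) : Prop :=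
  ∀ t ⊆ s, ∃ A ∈ 𝒜, ∀ a ∈ s, a ∈ A ↔ a ∈ t

/-- VC dimension of a family of sets: the largest size of a shattered finite set
(`⊤` if there are arbitrarily large ones). -/
def vcDimSets {α : Type*} (𝒜 : Set (Set α)) : ℕ∞ :=
  ⨆ s : {s : Finset α // Shatters 𝒜 s}, (s.1.card : ℕ∞)

/-- The (strict) subgraph `{(x, t) | t < h x}` of a real-valued function. -/
def subgraph {X : Type*} (h : X → ℝ) : Set (X × ℝ) := {p | p.2 < h p.1}

/-- VC dimension of a class of real-valued hypotheses, that is, the VC dimension of the family of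
its subgraphs (also called the pseudo-dimension). For a `{-1, 1}`-valued class this is the usual
VC dimension of binary classifiers. -/
def vcDim {X : Type*} (H : Set (X → ℝ)) : ℕ∞ := vcDimSets (subgraph '' H)

/-- The mixed model `α h + (1 - α) g`. -/
def mix {X : Type*} (α : ℝ) (h g : X → ℝ) : X → ℝ := fun x => α * h x + (1 - α) * g x

section Risk

variable {X : Type*} {Y : Set ℝ}

/-- True risk `E_{(x,y) ∼ D} ℓ(h(x), y)`. -/
def risk [MeasurableSpace X] (ℓ : ℝ → ℝ → ℝ) (D : Measure (X × Y)) (h : X → ℝ) : ℝ :=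
  ∫ z, ℓ (h z.1) (z.2 : ℝ) ∂D

/-- Empirical risk of `h` on the finite data set `s` (a family, so that repeated data points are
counted with multiplicity). -/
def empRisk {ι : Type*} [Fintype ι] (ℓ : ℝ → ℝ → ℝ) (s : ι → X × Y) (h : X → ℝ) : ℝ :=
  (Fintype.card ι : ℝ)⁻¹ * ∑ k, ℓ (h (s k).1) ((s k).2 : ℝ)

/-- Worst-case disagreement `λ_H(s)` of two members of `H` on the data set `s`, in absolute
loss. -/
def disagreement {ι : Type*} [Fintype ι] (H : Set (X → ℝ)) (s : ι → X × Y) : ℝ :=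
  ⨆ p : H × H, (Fintype.card ι : ℝ)⁻¹ * ∑ k, |p.1.1 (s k).1 - p.2.1 (s k).1|

end Risk

/-- The average `(1/|ι|) ∑_j D_j` of finitely many distributions. -/
def avgDist {ι Z : Type*} [Fintype ι] [MeasurableSpace Z] (D : ι → Measure Z) : Measure Z :=
  (Fintype.card ι : ℝ≥0∞)⁻¹ • ∑ j, D j

/-- The distance `‖P - Q‖₁ = ∫ |p - q|` of two finite measures, where `p`, `q` are their densities.
The densities are taken with respect to `P + Q`; any other `σ`-finite measure that dominates both
`P` and `Q` gives the same value. -/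
def l1Dist {Z : Type*} [MeasurableSpace Z] (P Q : Measure Z) : ℝ :=
  ∫ z, |(P.rnDeriv (P + Q) z).toReal - (Q.rnDeriv (P + Q) z).toReal| ∂(P + Q)

end FedMix

end

namespace FedMix

/-! Both losses are squares of a function convex in the prediction, so the loss of the mixture is at
most $2\alpha^2$ times the loss of the local model plus $2(1-\alpha)^2$ times that of the global one
(`risk_mix_le`). The two models can then be treated separately. The global model passes from the
average distribution to that of the client at the price `B * l1Dist`
(`integral_le_integral_add_l1Dist`). The empirical risks of the local model and of `hstar` differ by
at most `G * disagreement`, which bounds the gap between any two members of the class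
(`empRisk_le_add_disagreement`).

What remains is uniform convergence at rate $\sqrt{(d+\log(1/\delta))/m}$ without a logarithm of $m$
(`measure_risk_deviation_le`). Sauer–Shelah and random separating points bound packings of set
families (`log_card_le_of_separated`). Subgraphs on a grid of thresholds carry the bound over to
empirical $L^1$ covers (`exists_l1_cover`). Chaining over these covers bounds the exponential moment
of the Rademacher process (`sum_exp_selector_le`). Symmetrization transfers it to the empirical
process (`lintegral_exp_deviation_le`), and Markov's inequality gives the tail directly
(`measure_deviation_le`).

Suprema over the class are replaced throughout by selectors, data-dependent members of the class, so
no measurability of a supremum is needed. A selector may also read auxiliary data that depend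
arbitrarily on the sample. This matters because the local model is trained with the global data. -/

/-! ### Sauer–Shelah and packing numbers of set families -/

theorem Shatters.card_le_of_vcDimSets_le {α : Type*} {𝒜 : Set (Set α)} {d : ℕ}
    (hd : vcDimSets 𝒜 ≤ d) {s : Finset α} (hs : Shatters 𝒜 s) : s.card ≤ d := by
  have h : ((s.card : ℕ) : ℕ∞) ≤ vcDimSets 𝒜 :=
    le_iSup (fun s : {s : Finset α // Shatters 𝒜 s} => (s.1.card : ℕ∞)) ⟨s, hs⟩
  exact_mod_cast h.trans hd

/-- Sauer–Shelah: a family with distinct traces on `s` has polynomially many members. -/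
theorem card_le_sum_choose_of_traces {α J : Type*} {𝒜 : Set (Set α)} {d : ℕ}
    (hd : vcDimSets 𝒜 ≤ d) (s : Finset α) (I : Finset J) (A : J → Set α)
    (hA : ∀ a ∈ I, A a ∈ 𝒜)
    (hinj : ∀ a ∈ I, ∀ b ∈ I, (∀ p ∈ s, p ∈ A a ↔ p ∈ A b) → a = b) :
    I.card ≤ ∑ k ∈ Finset.Iic d, s.card.choose k := by
  classical
  let tr : J → Finset s := fun a => Finset.univ.filter fun p => (p : α) ∈ A a
  have hcard : (I.image tr).card = I.card := by
    refine Finset.card_image_of_injOn fun a ha b hb hab => hinj a ha b hb fun p hp => ?_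
    have := Finset.ext_iff.1 hab ⟨p, hp⟩
    simpa [tr] using this
  have hvc : (I.image tr).vcDim ≤ d := by
    refine Finset.sup_le fun t ht => ?_
    rw [Finset.mem_shatterer] at ht
    have hsh : Shatters 𝒜 (t.map (Function.Embedding.subtype _)) := by
      intro r hr
      obtain ⟨w, hw, hwt⟩ := ht (t := t.filter fun p => (p : α) ∈ r) (Finset.filter_subset _ _)
      obtain ⟨a, ha, rfl⟩ := Finset.mem_image.1 hw
      refine ⟨A a, hA a ha, fun p hp => ?_⟩
      obtain ⟨q, hq, rfl⟩ := Finset.mem_map.1 hp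
      have := Finset.ext_iff.1 hwt q
      simpa [tr, hq] using this
    simpa using hsh.card_le_of_vcDimSets_le hd
  calc I.card = (I.image tr).card := hcard.symm
    _ ≤ (I.image tr).shatterer.card := Finset.card_le_card_shatterer _
    _ ≤ ∑ k ∈ Finset.Iic (I.image tr).vcDim, (Fintype.card s).choose k :=
        Finset.card_shatterer_le_sum_vcDim
    _ ≤ ∑ k ∈ Finset.Iic d, s.card.choose k := by
        rw [Fintype.card_coe]
        exact Finset.sum_le_sum_of_subset (Finset.Iic_subset_Iic.2 hvc)

/-- Since $x\le1$, each $x^d$ may be raised to $x^j$ with $j\le d$; the binomial theorem and $1+x\le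
e^x$ finish. The free parameter `x` is tuned later to the separation. -/
theorem pow_mul_sum_choose_le (d k : ℕ) {x : ℝ} (hx0 : 0 ≤ x) (hx1 : x ≤ 1) :
    x ^ d * ((∑ j ∈ Finset.Iic d, k.choose j : ℕ) : ℝ) ≤ Real.exp (k * x) := by
  have h1 : x ^ d * ((∑ j ∈ Finset.Iic d, k.choose j : ℕ) : ℝ)
      ≤ ∑ j ∈ Finset.Iic d, x ^ j * (k.choose j : ℝ) := by
    push_cast
    rw [Finset.mul_sum]
    refine Finset.sum_le_sum fun j hj => ?_
    exact mul_le_mul_of_nonneg_right (pow_le_pow_of_le_one hx0 hx1 (Finset.mem_Iic.1 hj))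
      (Nat.cast_nonneg _)
  have h2 : ∑ j ∈ Finset.Iic d, x ^ j * (k.choose j : ℝ) ≤ (x + 1) ^ k := by
    rw [add_pow]
    simp only [one_pow, mul_one]
    have h3 : ∑ j ∈ Finset.Iic d, x ^ j * (k.choose j : ℝ)
        ≤ ∑ j ∈ Finset.Iic d ∪ Finset.range (k + 1), x ^ j * (k.choose j : ℝ) :=
      Finset.sum_le_sum_of_subset_of_nonneg Finset.subset_union_left
        fun _ _ _ => by positivity
    refine h3.trans_eq (Finset.sum_subset Finset.subset_union_right fun j _ hj => ?_).symm
    rw [Finset.mem_range, not_lt] at hj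
    rw [Nat.choose_eq_zero_of_lt (by omega)]
    simp
  refine h1.trans (h2.trans ?_)
  rw [Real.exp_nat_mul]
  exact pow_le_pow_left₀ (by positivity) (Real.add_one_le_exp x) k

/-- Greedy choice of `k` points that separate all but a small share of the pairs. -/
theorem exists_finset_separating {T α J : Type*} [Fintype T] [Nonempty T] (φ : T → α)
    (I : Finset J) (A : J → Set α) {ε : ℝ} (hε : ε ≤ 1)
    (hsep : ∀ a ∈ I, ∀ b ∈ I, a ≠ b →
      ε * Fintype.card T ≤ (Nat.card {t // ¬(φ t ∈ A a ↔ φ t ∈ A b)} : ℝ)) (k : ℕ) :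
    ∃ s : Finset α, s.card ≤ k ∧
      (Nat.card {p : J × J // (p.1 ∈ I ∧ p.2 ∈ I ∧ p.1 ≠ p.2) ∧
        ∀ q ∈ s, q ∈ A p.1 ↔ q ∈ A p.2} : ℝ) ≤ (1 - ε) ^ k * (I.card : ℝ) ^ 2 := by
  classical
  have key : ∀ s : Finset α, Nat.card {p : J × J // (p.1 ∈ I ∧ p.2 ∈ I ∧ p.1 ≠ p.2) ∧
        ∀ q ∈ s, q ∈ A p.1 ↔ q ∈ A p.2} =
        (I.offDiag.filter fun p => ∀ q ∈ s, q ∈ A p.1 ↔ q ∈ A p.2).card := by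
    intro s
    rw [← Nat.card_eq_finsetCard]
    refine Nat.card_congr (Equiv.subtypeEquivRight fun p => ?_)
    simp [Finset.mem_offDiag]
  simp only [key]
  induction k with
  | zero =>
    refine ⟨∅, by simp, ?_⟩
    simp only [Finset.notMem_empty, false_implies, implies_true, Finset.filter_true, pow_zero,
      one_mul, Finset.offDiag_card]
    rw [sq]
    exact_mod_cast Nat.sub_le _ _
  | succ k ih =>
    obtain ⟨s, hs, hU⟩ := ih
    set U := I.offDiag.filter fun p => ∀ q ∈ s, q ∈ A p.1 ↔ q ∈ A p.2 with hUdef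
    -- Double counting: each unseparated pair is separated by at least a share `ε` of the `t`, so
    -- some `t` separates at least a share `ε` of the pairs.
    have hsum : ∑ _t : T, ε * (U.card : ℝ) ≤
        ∑ t : T, ((U.filter fun p => ¬(φ t ∈ A p.1 ↔ φ t ∈ A p.2)).card : ℝ) := by
      have h1 : ∑ t : T, ((U.filter fun p => ¬(φ t ∈ A p.1 ↔ φ t ∈ A p.2)).card : ℝ) =
          ∑ p ∈ U, (Nat.card {t // ¬(φ t ∈ A p.1 ↔ φ t ∈ A p.2)} : ℝ) := by
        simp only [Nat.card_eq_fintype_card, Fintype.card_subtype, Finset.card_filter]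
        push_cast
        rw [Finset.sum_comm]
      rw [h1]
      calc ∑ _t : T, ε * (U.card : ℝ) = ∑ _p ∈ U, ε * Fintype.card T := by
            simp; ring
        _ ≤ _ := Finset.sum_le_sum fun p hp => by
            have hp' := Finset.mem_offDiag.1 (Finset.mem_filter.1 hp).1
            exact hsep _ hp'.1 _ hp'.2.1 hp'.2.2
    obtain ⟨t, -, ht⟩ := Finset.exists_le_of_sum_le Finset.univ_nonempty hsum
    refine ⟨insert (φ t) s, (Finset.card_insert_le _ _).trans (by omega), ?_⟩
    have h2 : (I.offDiag.filter fun p => ∀ q ∈ insert (φ t) s, q ∈ A p.1 ↔ q ∈ A p.2) =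
        U.filter fun p => (φ t ∈ A p.1 ↔ φ t ∈ A p.2) := by
      ext p
      simp only [hUdef, Finset.mem_filter, Finset.mem_insert, forall_eq_or_imp]
      tauto
    have h3 := Finset.card_filter_add_card_filter_not (s := U)
      (fun p => (φ t ∈ A p.1 ↔ φ t ∈ A p.2))
    have h3' : ((U.filter fun p => (φ t ∈ A p.1 ↔ φ t ∈ A p.2)).card : ℝ) +
      ((U.filter fun p => ¬(φ t ∈ A p.1 ↔ φ t ∈ A p.2)).card : ℝ) = U.card := by
      exact_mod_cast h3
    rw [h2, pow_succ]
    nlinarith [mul_le_mul_of_nonneg_left hU (sub_nonneg.2 hε)]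

/-- Dudley's packing bound for set families of finite VC dimension. -/
theorem log_card_le_of_separated {T α J : Type*} [Fintype T] [Nonempty T] (φ : T → α)
    {𝒜 : Set (Set α)} {d : ℕ} (hd : vcDimSets 𝒜 ≤ d)
    (I : Finset J) (A : J → Set α) (hA : ∀ a ∈ I, A a ∈ 𝒜) {ε : ℝ} (hε0 : 0 < ε) (hε : ε ≤ 1)
    (hsep : ∀ a ∈ I, ∀ b ∈ I, a ≠ b →
      ε * Fintype.card T ≤ (Nat.card {t // ¬(φ t ∈ A a ↔ φ t ∈ A b)} : ℝ)) :
    Real.log I.card ≤ 2 * d * Real.log (4 / ε) + ε / 2 := by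
  classical
  have hlog4 : 0 ≤ Real.log (4 / ε) := Real.log_nonneg (by rw [le_div_iff₀ hε0]; linarith)
  rcases I.eq_empty_or_nonempty with rfl | hI
  · simp; positivity
  have hN : (1 : ℝ) ≤ I.card := by exact_mod_cast hI.card_pos
  have hlN : 0 ≤ Real.log I.card := Real.log_nonneg hN
  -- The least natural number with $k\varepsilon>2\log|I|$. Then $(1-\varepsilon)^k|I|^2<1$, so no
  -- pair stays unseparated and the traces on `s` are distinct.
  set k : ℕ := ⌊2 * Real.log I.card / ε⌋₊ + 1 with hk
  have hk1 : (k : ℝ) ≤ 2 * Real.log I.card / ε + 1 := by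
    rw [hk]; push_cast
    linarith [Nat.floor_le (a := 2 * Real.log I.card / ε) (by positivity)]
  have hk2 : 2 * Real.log I.card / ε < k := by
    rw [hk]; push_cast; exact Nat.lt_floor_add_one _
  obtain ⟨s, hs, hU⟩ := exists_finset_separating φ I A hε hsep k
  have hlt : (1 - ε) ^ k * (I.card : ℝ) ^ 2 < 1 := by
    have h1 : (1 - ε) ^ k ≤ Real.exp (-(k * ε)) := by
      rw [← mul_neg, Real.exp_nat_mul]
      exact pow_le_pow_left₀ (by linarith) (by linarith [Real.add_one_le_exp (-ε)]) k
    have h2 : (I.card : ℝ) ^ 2 = Real.exp (2 * Real.log I.card) := by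
      rw [two_mul, Real.exp_add, Real.exp_log (by linarith), sq]
    calc (1 - ε) ^ k * (I.card : ℝ) ^ 2
        ≤ Real.exp (-(k * ε)) * Real.exp (2 * Real.log I.card) := by
          rw [h2]; exact mul_le_mul_of_nonneg_right h1 (Real.exp_pos _).le
      _ = Real.exp (2 * Real.log I.card - k * ε) := by rw [← Real.exp_add]; ring_nf
      _ < 1 := by
          rw [Real.exp_lt_one_iff]
          rw [div_lt_iff₀ hε0] at hk2
          linarith
  have hfin : Finite {p : J × J // (p.1 ∈ I ∧ p.2 ∈ I ∧ p.1 ≠ p.2) ∧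
        ∀ q ∈ s, q ∈ A p.1 ↔ q ∈ A p.2} :=
    Set.Finite.subset (I ×ˢ I).finite_toSet fun p hp => by
      simpa using And.intro hp.1.1 hp.1.2.1
  have h0 : Nat.card {p : J × J // (p.1 ∈ I ∧ p.2 ∈ I ∧ p.1 ≠ p.2) ∧
        ∀ q ∈ s, q ∈ A p.1 ↔ q ∈ A p.2} = 0 := by
    have := hU.trans_lt hlt
    have h' : Nat.card {p : J × J // (p.1 ∈ I ∧ p.2 ∈ I ∧ p.1 ≠ p.2) ∧
        ∀ q ∈ s, q ∈ A p.1 ↔ q ∈ A p.2} < 1 := by exact_mod_cast this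
    omega
  have hempty := Finite.card_eq_zero_iff.1 h0
  have hsauer := card_le_sum_choose_of_traces hd s I A hA fun a ha b hb hab => by
    by_contra hne
    exact hempty.false ⟨(a, b), ⟨ha, hb, hne⟩, hab⟩
  have hmono : I.card ≤ ∑ j ∈ Finset.Iic d, k.choose j :=
    hsauer.trans (Finset.sum_le_sum fun j _ => Nat.choose_le_choose j hs)
  -- With $x=\varepsilon/4$ the exponent $kx$ is at most $\tfrac12\log|I|+\varepsilon/4$, and the
  -- first term is absorbed on the left.
  have hx := pow_mul_sum_choose_le d k (x := ε / 4) (by positivity) (by linarith)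
  have h5 : (ε / 4) ^ d * (I.card : ℝ) ≤ Real.exp (k * (ε / 4)) := by
    refine le_trans (mul_le_mul_of_nonneg_left ?_ (by positivity)) hx
    exact_mod_cast hmono
  have h6 := Real.log_le_log (by positivity) h5
  rw [Real.log_exp, Real.log_mul (by positivity) (by positivity), Real.log_pow] at h6
  have h7 : Real.log (ε / 4) = - Real.log (4 / ε) := by
    rw [← Real.log_inv, inv_div]
  have h8 : (k : ℝ) * (ε / 4) ≤ Real.log I.card / 2 + ε / 4 := by
    calc (k : ℝ) * (ε / 4) ≤ (2 * Real.log I.card / ε + 1) * (ε / 4) :=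
          mul_le_mul_of_nonneg_right hk1 (by positivity)
      _ = _ := by field_simp; ring
  rw [h7] at h6
  linarith

/-! ### Packing and covering numbers in empirical L¹ distance -/

/-- For $a\le b$ the thresholds that tell `a` from `b` include the integers in $[a,b)$, of which
there are $\lceil b\rceil-\lceil a\rceil\ge b-a-1$. This turns distances between values into counts
of points that separate subgraphs. -/
theorem abs_sub_sub_one_le_card_grid (L : ℕ) {a b : ℝ} (ha : 0 ≤ a) (hb : 0 ≤ b)
    (haL : a ≤ L) (hbL : b ≤ L) :
    |a - b| - 1 ≤ (Nat.card {j : Fin L // ¬(((j : ℕ) : ℝ) < a ↔ ((j : ℕ) : ℝ) < b)} : ℝ) := by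
  wlog hab : a ≤ b generalizing a b
  · have := this hb ha hbL haL (le_of_not_ge hab)
    rw [abs_sub_comm]
    refine this.trans_eq ?_
    congr 1
    exact Nat.card_congr (Equiv.subtypeEquivRight fun j => not_congr iff_comm)
  have hmem : ∀ j : ℕ, j ∈ Finset.Ico ⌈a⌉₊ ⌈b⌉₊ → a ≤ j ∧ (j : ℝ) < b := fun j hj => by
    rw [Finset.mem_Ico, Nat.ceil_le, Nat.lt_ceil] at hj
    exact hj
  let f : Finset.Ico ⌈a⌉₊ ⌈b⌉₊ → {j : Fin L // ¬(((j : ℕ) : ℝ) < a ↔ ((j : ℕ) : ℝ) < b)} :=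
    fun j => ⟨⟨j, by exact_mod_cast (hmem j j.2).2.trans_le hbL⟩, by
      have := hmem j j.2
      simp only [this.2, iff_true, not_lt]
      exact this.1⟩
  have hf : Function.Injective f := fun j j' h => by
    have := congrArg (fun t => (t.1 : ℕ)) h
    exact Subtype.ext this
  have hcard := Nat.card_le_card_of_injective f hf
  rw [Nat.card_eq_finsetCard, Nat.card_Ico] at hcard
  have h1 : (⌈b⌉₊ : ℝ) - ⌈a⌉₊ ≤ ((⌈b⌉₊ - ⌈a⌉₊ : ℕ) : ℝ) := by
    rw [Nat.cast_sub (Nat.ceil_mono hab)]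
  have h2 : ((⌈b⌉₊ - ⌈a⌉₊ : ℕ) : ℝ) ≤
    (Nat.card {j : Fin L // ¬(((j : ℕ) : ℝ) < a ↔ ((j : ℕ) : ℝ) < b)} : ℝ) := by
    exact_mod_cast hcard
  rw [abs_sub_comm, abs_of_nonneg (sub_nonneg.2 hab)]
  linarith [Nat.le_ceil b, Nat.ceil_lt_add_one ha]

/-- Packing bound in empirical `L¹` distance for a class of functions of finite pseudo-dimension
with values in an interval of length `R`. -/
theorem log_card_le_of_l1_separated {X P : Type*} [Fintype P] [Nonempty P] (x : P → X)
    {H : Set (X → ℝ)} {d : ℕ} (hd : vcDim H ≤ d) {c R : ℝ} (hR : 0 < R)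
    (hrange : ∀ h ∈ H, ∀ x, c ≤ h x ∧ h x ≤ c + R)
    {η : ℝ} (hη0 : 0 < η) (hη : η ≤ 1) (I : Finset (X → ℝ)) (hI : ∀ a ∈ I, a ∈ H)
    (hsep : ∀ a ∈ I, ∀ b ∈ I, a ≠ b →
      η * R * Fintype.card P ≤ ∑ p, |a (x p) - b (x p)|) :
    Real.log I.card ≤ 2 * d * Real.log (8 / η) + 1 / 4 := by
  classical
  -- Rounding costs one threshold out of `L` at each point. As $L\eta\ge2$, this is at most half of
  -- the separation, which leaves $\varepsilon=\eta/2$ for the subgraphs.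
  set L := ⌈2 / η⌉₊ with hL
  have hLη : 2 / η ≤ L := Nat.le_ceil _
  have hL0 : (0 : ℝ) < L := lt_of_lt_of_le (by positivity) hLη
  have hLpos : 0 < L := by exact_mod_cast hL0
  have : Nonempty (Fin L) := ⟨⟨0, hLpos⟩⟩
  have h := log_card_le_of_separated (T := P × Fin L)
    (fun t : P × Fin L => (x t.1, c + R * (((t.2 : ℕ) : ℝ) / L))) (𝒜 := subgraph '' H) hd I
    subgraph (fun a ha => ⟨a, hI a ha, rfl⟩) (ε := η / 2) (by positivity) (by linarith) ?_
  · have h8 : 4 / (η / 2) = 8 / η := by field_simp; norm_num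
    rw [h8] at h
    linarith
  intro a ha b hb hab
  have hiff : ∀ (g : X → ℝ) (t : P × Fin L),
      (x t.1, c + R * (((t.2 : ℕ) : ℝ) / L)) ∈ subgraph g ↔
        ((t.2 : ℕ) : ℝ) < L * ((g (x t.1) - c) / R) := by
    intro g t
    simp only [subgraph, Set.mem_ofPred_eq]
    rw [← lt_sub_iff_add_lt', ← lt_div_iff₀' hR, div_lt_iff₀' hL0]
  have hcount : (Nat.card {t : P × Fin L // ¬((x t.1, c + R * (((t.2 : ℕ) : ℝ) / L)) ∈ subgraph a ↔
      (x t.1, c + R * (((t.2 : ℕ) : ℝ) / L)) ∈ subgraph b)} : ℝ) =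
      ∑ p : P, (Nat.card {j : Fin L // ¬(((j : ℕ) : ℝ) < L * ((a (x p) - c) / R) ↔
        ((j : ℕ) : ℝ) < L * ((b (x p) - c) / R))} : ℝ) := by
    simp only [hiff]
    simp only [Nat.card_eq_fintype_card, Fintype.card_subtype, Finset.card_filter]
    push_cast
    rw [Fintype.sum_prod_type]
  rw [hcount]
  have hbd : ∀ g ∈ H, ∀ y, 0 ≤ L * ((g y - c) / R) ∧ L * ((g y - c) / R) ≤ L := by
    intro g hg y
    have h1 := hrange g hg y
    constructor
    · exact mul_nonneg hL0.le (div_nonneg (by linarith) hR.le)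
    · exact mul_le_of_le_one_right hL0.le ((div_le_one hR).2 (by linarith))
  have hlow : ∑ p : P, ((L / R) * |a (x p) - b (x p)| - 1) ≤
      ∑ p : P, (Nat.card {j : Fin L // ¬(((j : ℕ) : ℝ) < L * ((a (x p) - c) / R) ↔
        ((j : ℕ) : ℝ) < L * ((b (x p) - c) / R))} : ℝ) := by
    refine Finset.sum_le_sum fun p _ => ?_
    have h1 := hbd a (hI a ha) (x p)
    have h2 := hbd b (hI b hb) (x p)
    refine le_trans (le_of_eq ?_) (abs_sub_sub_one_le_card_grid L h1.1 h2.1 h1.2 h2.2)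
    have : L * ((a (x p) - c) / R) - L * ((b (x p) - c) / R) = (L / R) * (a (x p) - b (x p)) := by
      field_simp; ring
    rw [this, abs_mul, abs_of_pos (div_pos hL0 hR)]
  refine le_trans ?_ hlow
  rw [Finset.sum_sub_distrib, ← Finset.mul_sum]
  have h3 := mul_le_mul_of_nonneg_left (hsep a ha b hb hab) (show 0 ≤ L / R by positivity)
  have h4 : L / R * (η * R * Fintype.card P) = L * η * Fintype.card P := by field_simp
  rw [h4] at h3
  simp only [Fintype.card_prod, Fintype.card_fin, Finset.sum_const, Finset.card_univ, nsmul_eq_mul,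
    mul_one]
  push_cast
  have h5 : 2 ≤ L * η := (div_le_iff₀ hη0).1 hLη
  nlinarith [mul_le_mul_of_nonneg_right h5 (Nat.cast_nonneg (α := ℝ) (Fintype.card P))]

/-- A maximal separated family is a cover. -/
theorem exists_cover_of_log_card_le {V : Type*} (H : Set V) (r : V → V → ℝ)
    (hsymm : ∀ a b, r a b = r b a) {s K : ℝ}
    (hpack : ∀ I : Finset V, (∀ a ∈ I, a ∈ H) → (∀ a ∈ I, ∀ b ∈ I, a ≠ b → s ≤ r a b) →
      Real.log I.card ≤ K) :
    ∃ I : Finset V, (∀ a ∈ I, a ∈ H) ∧ Real.log I.card ≤ K ∧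
      ∀ h ∈ H, ∃ a ∈ I, h = a ∨ r h a < s := by
  classical
  by_contra hcon
  push Not at hcon
  -- If no separated family were a cover, each could be enlarged, giving separated families of every
  -- size, against the packing bound.
  have hall : ∀ n : ℕ, ∃ I : Finset V, (∀ a ∈ I, a ∈ H) ∧
      (∀ a ∈ I, ∀ b ∈ I, a ≠ b → s ≤ r a b) ∧ I.card = n := by
    intro n
    induction n with
    | zero => exact ⟨∅, by simp, by simp, rfl⟩
    | succ n ih =>
      obtain ⟨I, hI, hsep, hn⟩ := ih
      obtain ⟨h, hh, hfar⟩ := hcon I hI (hpack I hI hsep)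
      refine ⟨insert h I, ?_, ?_, ?_⟩
      · simpa using ⟨hh, hI⟩
      · intro a ha b hb hab
        rcases Finset.mem_insert.1 ha with rfl | ha' <;> rcases Finset.mem_insert.1 hb with rfl | hb'
        · exact absurd rfl hab
        · exact (hfar b hb').2
        · rw [hsymm]; exact (hfar a ha').2
        · exact hsep a ha' b hb' hab
      · rw [Finset.card_insert_of_notMem fun hmem => (hfar h hmem).1 rfl, hn]
  obtain ⟨I, hI, hsep, hn⟩ := hall (⌊Real.exp K⌋₊ + 1)
  have h1 := hpack I hI hsep
  rw [hn] at h1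
  have h2 : ((⌊Real.exp K⌋₊ + 1 : ℕ) : ℝ) ≤ Real.exp K :=
    (Real.log_le_iff_le_exp (by positivity)).1 h1
  push_cast at h2
  linarith [Nat.lt_floor_add_one (Real.exp K)]

/-- Empirical `L¹` covers at the scales `4⁻ʲ`. -/
theorem exists_l1_cover {X P : Type*} [Fintype P] [Nonempty P] (x : P → X)
    {H : Set (X → ℝ)} {d : ℕ} (hd : vcDim H ≤ d) {c R : ℝ} (hR : 0 < R)
    (hrange : ∀ h ∈ H, ∀ x, c ≤ h x ∧ h x ≤ c + R) (j : ℕ) :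
    ∃ I : Finset (X → ℝ), (∀ a ∈ I, a ∈ H) ∧ Real.log I.card ≤ 5 * d * (j + 1) ∧
      ∀ h ∈ H, ∃ a ∈ I, ∑ p, |h (x p) - a (x p)| ≤ (1 / 4) ^ j * R * Fintype.card P := by
  have hpack : ∀ I : Finset (X → ℝ), (∀ a ∈ I, a ∈ H) →
      (∀ a ∈ I, ∀ b ∈ I, a ≠ b →
        (1 / 4) ^ j * R * Fintype.card P ≤ ∑ p, |a (x p) - b (x p)|) →
      Real.log I.card ≤ 5 * d * (j + 1) := by
    intro I hI hsep
    have hb := log_card_le_of_l1_separated x hd hR hrange (η := (1 / 4) ^ j) (by positivity)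
      (pow_le_one₀ (by norm_num) (by norm_num)) I hI hsep
    have hlog : Real.log (8 / (1 / 4) ^ j) = (3 + 2 * j) * Real.log 2 := by
      have : (8 : ℝ) / (1 / 4) ^ j = 2 ^ (3 + 2 * j) := by
        rw [pow_add, pow_mul, one_div, inv_pow, div_inv_eq_mul]; norm_num
      rw [this, Real.log_pow]; push_cast; ring
    rw [hlog] at hb
    have hl1 := Real.log_two_lt_d9
    have hl2 := Real.log_two_gt_d9
    -- The additive `1 / 4` is absorbed by `d` when $d\ge1$. For $d=0$ it is below $\log2$, so the
    -- packing has at most one element and its logarithm vanishes.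
    rcases Nat.eq_zero_or_pos d with rfl | hd0
    · simp only [CharP.cast_eq_zero, mul_zero, zero_mul, zero_add] at hb ⊢
      by_contra hpos
      push Not at hpos
      have hc : 2 ≤ I.card := by
        by_contra hlt
        have : I.card = 0 ∨ I.card = 1 := by omega
        rcases this with h | h <;> simp [h] at hpos
      have : Real.log 2 ≤ Real.log I.card :=
        Real.log_le_log (by norm_num) (by exact_mod_cast hc)
      linarith
    · have hd1 : (1 : ℝ) ≤ d := by exact_mod_cast hd0
      have hj : (0 : ℝ) ≤ j := Nat.cast_nonneg j
      have h1 : (3 + 2 * (j : ℝ)) * Real.log 2 ≤ (3 + 2 * j) * 0.7 :=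
        mul_le_mul_of_nonneg_left (by linarith) (by positivity)
      have h2 := mul_le_mul_of_nonneg_left h1 (show (0 : ℝ) ≤ 2 * d by positivity)
      nlinarith [mul_nonneg (by linarith : (0:ℝ) ≤ d) hj]
  obtain ⟨I, hI, hcard, hcov⟩ := exists_cover_of_log_card_le H
    (fun a b => ∑ p, |a (x p) - b (x p)|) (fun a b => by simp only [abs_sub_comm])
    (s := (1 / 4) ^ j * R * Fintype.card P) (K := 5 * d * (j + 1)) hpack
  refine ⟨I, hI, hcard, fun h hh => ?_⟩
  obtain ⟨a, ha, rfl | hlt⟩ := hcov h hh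
  · exact ⟨h, ha, by simp only [sub_self, abs_zero, Finset.sum_const_zero]; positivity⟩
  · exact ⟨a, ha, hlt.le⟩

/-! ### Rademacher sums and chaining -/

/-- The sign `1` or `-1` encoded by a Boolean. -/
def sgn (b : Bool) : ℝ := if b then 1 else -1

theorem abs_sgn (b : Bool) : |sgn b| = 1 := by cases b <;> simp [sgn]

/-- The sum over signs factors over the coordinates, and each factor is $2\cosh u_k\le
2e^{u_k^2/2}$. -/
theorem sum_exp_sgn_le {ι : Type*} [Fintype ι] [DecidableEq ι] (u : ι → ℝ) :
    ∑ σ : ι → Bool, Real.exp (∑ k, sgn (σ k) * u k) ≤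
      2 ^ Fintype.card ι * Real.exp ((∑ k, u k ^ 2) / 2) := by
  classical
  have h1 : ∑ σ : ι → Bool, Real.exp (∑ k, sgn (σ k) * u k) =
      ∏ k, ∑ b : Bool, Real.exp (sgn b * u k) := by
    rw [Finset.prod_univ_sum, Fintype.piFinset_univ]
    exact Finset.sum_congr rfl fun σ _ => Real.exp_sum _ _
  have h2 : (2 : ℝ) ^ Fintype.card ι * Real.exp ((∑ k, u k ^ 2) / 2) =
      ∏ k, (2 * Real.exp (u k ^ 2 / 2)) := by
    rw [Finset.prod_mul_distrib, Finset.prod_const, Finset.card_univ, ← Real.exp_sum,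
      Finset.sum_div]
  rw [h1, h2]
  refine Finset.prod_le_prod (fun k _ => Finset.sum_nonneg fun b _ => (Real.exp_pos _).le)
    fun k _ => ?_
  have h3 := Real.cosh_le_exp_half_sq (u k)
  rw [Real.cosh_eq] at h3
  simp only [Fintype.sum_bool, sgn]
  norm_num
  linarith

/-- Jensen's inequality with the missing weight placed at the point 0, proved from the tangent line
of the exponential at `Y`. It combines the levels of a chain when only finitely many weights are in
use. -/
theorem exp_sum_mul_le {J : Type*} (s : Finset J) (w y : J → ℝ) (hw : ∀ i ∈ s, 0 ≤ w i)
    (hw1 : ∑ i ∈ s, w i ≤ 1) :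
    Real.exp (∑ i ∈ s, w i * y i) ≤ ∑ i ∈ s, w i * Real.exp (y i) + (1 - ∑ i ∈ s, w i) := by
  set Y := ∑ i ∈ s, w i * y i with hY
  have h1 : ∀ t : ℝ, Real.exp Y * (1 + t - Y) ≤ Real.exp t := fun t => by
    have h := mul_le_mul_of_nonneg_left (Real.add_one_le_exp (t - Y)) (Real.exp_pos Y).le
    rw [← Real.exp_add] at h
    ring_nf at h ⊢
    exact h
  have h2 : ∑ i ∈ s, w i * (Real.exp Y * (1 + y i - Y)) ≤ ∑ i ∈ s, w i * Real.exp (y i) :=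
    Finset.sum_le_sum fun i hi => mul_le_mul_of_nonneg_left (h1 _) (hw i hi)
  have h3 : ∑ i ∈ s, w i * (Real.exp Y * (1 + y i - Y)) =
      Real.exp Y * ((1 - Y) * ∑ i ∈ s, w i + Y) := by
    rw [hY, mul_add, Finset.mul_sum, Finset.mul_sum, Finset.mul_sum, ← Finset.sum_add_distrib]
    exact Finset.sum_congr rfl fun i _ => by ring
  have h4 := h1 0
  rw [Real.exp_zero] at h4
  nlinarith [mul_le_mul_of_nonneg_left h4 (sub_nonneg.2 hw1)]

theorem sum_half_pow_le (J : ℕ) : ∑ i ∈ Finset.range J, (1 / 2 : ℝ) ^ (i + 1) ≤ 1 := by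
  have : ∑ i ∈ Finset.range J, (1 / 2 : ℝ) ^ (i + 1) = 1 - (1 / 2) ^ J := by
    induction J with
    | zero => simp
    | succ J ih => rw [Finset.sum_range_succ, ih, pow_succ]; ring
  rw [this]
  linarith [pow_pos (show (0 : ℝ) < 1 / 2 by norm_num) J]

theorem sum_half_pow_mul_le (J : ℕ) :
    ∑ i ∈ Finset.range J, (1 / 2 : ℝ) ^ (i + 1) * (i + 1) ≤ 2 := by
  have : ∑ i ∈ Finset.range J, (1 / 2 : ℝ) ^ (i + 1) * (i + 1) = 2 - (J + 2) * (1 / 2) ^ J := by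
    induction J with
    | zero => simp
    | succ J ih => rw [Finset.sum_range_succ, ih, pow_succ]; push_cast; ring
  rw [this]
  have : (0 : ℝ) ≤ (J + 2) * (1 / 2) ^ J := by positivity
  linarith

/-- Exponential moment of the maximum of a Rademacher sum over finitely many vectors. -/
theorem sum_exp_finset_le {ι : Type*} [Fintype ι] [DecidableEq ι] (Λ : Finset (ι → ℝ)) {p q : ℝ}
    (hcard : Real.log Λ.card ≤ p) (hq : ∀ u ∈ Λ, ∑ k, u k ^ 2 ≤ q)
    (w : (ι → Bool) → ι → ℝ) (hw : ∀ σ, w σ ∈ Λ) (t : ℝ) :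
    ∑ σ : ι → Bool, Real.exp (t * ∑ k, sgn (σ k) * w σ k - (p + t ^ 2 * q / 2)) ≤
      2 ^ Fintype.card ι := by
  have hstep : ∀ σ : ι → Bool, Real.exp (t * ∑ k, sgn (σ k) * w σ k) ≤
      ∑ u ∈ Λ, Real.exp (∑ k, sgn (σ k) * (t * u k)) := by
    intro σ
    have h := Finset.single_le_sum (f := fun u : ι → ℝ => Real.exp (∑ k, sgn (σ k) * (t * u k)))
      (fun _ _ => (Real.exp_pos _).le) (hw σ)
    refine le_trans (le_of_eq ?_) h
    rw [Finset.mul_sum]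
    congr 1
    exact Finset.sum_congr rfl fun k _ => by ring
  have hu : ∀ u ∈ Λ, ∑ σ : ι → Bool, Real.exp (∑ k, sgn (σ k) * (t * u k)) ≤
      2 ^ Fintype.card ι * Real.exp (t ^ 2 * q / 2) := by
    intro u hu
    refine (sum_exp_sgn_le _).trans (mul_le_mul_of_nonneg_left (Real.exp_le_exp.2 ?_)
      (by positivity))
    have h1 : ∑ k, (t * u k) ^ 2 = t ^ 2 * ∑ k, u k ^ 2 := by
      rw [Finset.mul_sum]; exact Finset.sum_congr rfl fun k _ => by ring
    have h2 := mul_le_mul_of_nonneg_left (hq u hu) (sq_nonneg t)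
    rw [h1]
    linarith
  have hsum : ∑ σ : ι → Bool, Real.exp (t * ∑ k, sgn (σ k) * w σ k) ≤
      Λ.card * (2 ^ Fintype.card ι * Real.exp (t ^ 2 * q / 2)) := by
    refine (Finset.sum_le_sum fun σ _ => hstep σ).trans ?_
    rw [Finset.sum_comm, ← nsmul_eq_mul]
    exact Finset.sum_le_card_nsmul _ _ _ hu
  have hne : 0 < Λ.card := Finset.card_pos.2 ⟨_, hw fun _ => true⟩
  have hp : (Λ.card : ℝ) ≤ Real.exp p :=
    (Real.log_le_iff_le_exp (by exact_mod_cast hne)).1 hcard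
  simp only [Real.exp_sub, ← Finset.sum_div]
  rw [div_le_iff₀ (Real.exp_pos _), Real.exp_add]
  refine hsum.trans ?_
  calc (Λ.card : ℝ) * (2 ^ Fintype.card ι * Real.exp (t ^ 2 * q / 2))
      ≤ Real.exp p * (2 ^ Fintype.card ι * Real.exp (t ^ 2 * q / 2)) :=
        mul_le_mul_of_nonneg_right hp (by positivity)
    _ = _ := by ring

/-- Exponential moment of a Rademacher sum along chains of links. -/
theorem sum_exp_chain_le {ι : Type*} [Fintype ι] [DecidableEq ι] (Λ : ℕ → Finset (ι → ℝ))
    {D W : ℝ} (hD : 0 ≤ D) (hcard : ∀ i, Real.log (Λ i).card ≤ 2 * D * (i + 1))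
    (hW : ∀ i, ∀ u ∈ Λ i, ∑ k, u k ^ 2 ≤ 10 * W * (1 / 4) ^ i)
    (w : (ι → Bool) → ℕ → ι → ℝ) (hw : ∀ σ i, w σ i ∈ Λ i) (l : ℝ) (hW0 : 0 ≤ W) (J : ℕ) :
    ∑ σ : ι → Bool, Real.exp (l * ∑ i ∈ Finset.range J, ∑ k, sgn (σ k) * w σ i k) ≤
      2 ^ Fintype.card ι * Real.exp (4 * D + 20 * l ^ 2 * W) := by
  -- The weights $2^{-(i+1)}$ balance the variance: dividing by $\omega_i$ cancels the decay
  -- $4^{-i}$ exactly and leaves $20l^2W$ at every level. The entropy $2D(i+1)$ stays summable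
  -- against them, with total at most $4D$.
  obtain ⟨ω, hω⟩ : ∃ ω : ℕ → ℝ, ∀ i, ω i = (1 / 2) ^ (i + 1) := ⟨_, fun _ => rfl⟩
  have hω0 : ∀ i, 0 < ω i := fun i => by rw [hω]; positivity
  obtain ⟨cst, hcst⟩ : ∃ cst : ℕ → ℝ, ∀ i, cst i = 2 * D * (i + 1) + 20 * l ^ 2 * W :=
    ⟨_, fun _ => rfl⟩
  obtain ⟨y, hy⟩ : ∃ y : (ι → Bool) → ℕ → ℝ, ∀ σ i, y σ i = ∑ k, sgn (σ k) * w σ i k :=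
    ⟨_, fun _ _ => rfl⟩
  simp only [← hy]
  have hlevel : ∀ i, ∑ σ : ι → Bool, Real.exp (l / ω i * y σ i - cst i) ≤
      2 ^ Fintype.card ι := by
    intro i
    have h := sum_exp_finset_le (Λ i) (hcard i) (hW i) (fun σ => w σ i) (fun σ => hw σ i)
      (l / ω i)
    have h3 : 2 * D * (i + 1) + (l / ω i) ^ 2 * (10 * W * (1 / 4) ^ i) / 2 = cst i := by
      have h4 : (1 / 4 : ℝ) ^ i = 4 * (ω i) ^ 2 := by
        rw [hω, ← pow_mul, mul_comm (i + 1) 2, pow_mul, pow_succ]; norm_num; ring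
      have := (hω0 i).ne'
      rw [h4, div_pow, hcst]
      field_simp
      ring
    rw [h3] at h
    simpa only [hy] using h
  have hω1 : ∑ i ∈ Finset.range J, ω i ≤ 1 := by
    simp only [hω]; exact sum_half_pow_le J
  have hsum : ∑ σ : ι → Bool, Real.exp (∑ i ∈ Finset.range J,
      ω i * (l / ω i * y σ i - cst i)) ≤ 2 ^ Fintype.card ι := by
    calc _ ≤ ∑ σ : ι → Bool, (∑ i ∈ Finset.range J, ω i * Real.exp (l / ω i * y σ i - cst i)
          + (1 - ∑ i ∈ Finset.range J, ω i)) :=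
          Finset.sum_le_sum fun σ _ => exp_sum_mul_le _ _ _ (fun i _ => (hω0 i).le) hω1
      _ = ∑ i ∈ Finset.range J, ω i * ∑ σ : ι → Bool, Real.exp (l / ω i * y σ i - cst i)
          + 2 ^ Fintype.card ι * (1 - ∑ i ∈ Finset.range J, ω i) := by
          rw [Finset.sum_add_distrib, Finset.sum_comm]
          simp only [← Finset.mul_sum, Finset.sum_const, Finset.card_univ, Fintype.card_fun,
            Fintype.card_bool, nsmul_eq_mul]
          push_cast
          rfl
      _ ≤ ∑ i ∈ Finset.range J, ω i * 2 ^ Fintype.card ι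
          + 2 ^ Fintype.card ι * (1 - ∑ i ∈ Finset.range J, ω i) := by
          refine add_le_add (Finset.sum_le_sum fun i _ => ?_) le_rfl
          exact mul_le_mul_of_nonneg_left (hlevel i) (hω0 i).le
      _ = 2 ^ Fintype.card ι := by rw [← Finset.sum_mul]; ring
  have hc : ∑ i ∈ Finset.range J, ω i * cst i ≤ 4 * D + 20 * l ^ 2 * W := by
    have h1 : ∑ i ∈ Finset.range J, ω i * cst i =
        2 * D * ∑ i ∈ Finset.range J, ω i * (i + 1)
          + 20 * l ^ 2 * W * ∑ i ∈ Finset.range J, ω i := by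
      rw [Finset.mul_sum, Finset.mul_sum, ← Finset.sum_add_distrib]
      exact Finset.sum_congr rfl fun i _ => by rw [hcst]; ring
    have h2 := mul_le_mul_of_nonneg_left (sum_half_pow_mul_le J) (show 0 ≤ 2 * D by linarith)
    have h3 := mul_le_mul_of_nonneg_left hω1 (show 0 ≤ 20 * l ^ 2 * W by positivity)
    simp only [← hω] at h2
    rw [h1]
    linarith
  calc ∑ σ : ι → Bool, Real.exp (l * ∑ i ∈ Finset.range J, y σ i)
      = ∑ σ : ι → Bool, Real.exp (∑ i ∈ Finset.range J, ω i * (l / ω i * y σ i - cst i))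
        * Real.exp (∑ i ∈ Finset.range J, ω i * cst i) := by
        refine Finset.sum_congr rfl fun σ _ => ?_
        rw [← Real.exp_add, ← Finset.sum_add_distrib, Finset.mul_sum]
        congr 1
        refine Finset.sum_congr rfl fun i _ => ?_
        have := (hω0 i).ne'
        field_simp
        ring
    _ ≤ 2 ^ Fintype.card ι * Real.exp (4 * D + 20 * l ^ 2 * W) := by
        rw [← Finset.sum_mul]
        exact mul_le_mul hsum (Real.exp_le_exp.2 hc) (Real.exp_pos _).le (by positivity)

/-- Exponential moment of the supremum of a Rademacher process, by chaining. The supremum is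
represented by a selector `g`. -/
theorem sum_exp_selector_le {ι V : Type*} [Fintype ι] [DecidableEq ι] (v : V → ι → ℝ)
    {D W : ℝ} (hD : 0 ≤ D) (hW0 : 0 ≤ W) (hW : ∀ h, ∑ k, v h k ^ 2 ≤ W) (N : ℕ → Finset V)
    (hcard : ∀ j, Real.log (N j).card ≤ D * (j + 1))
    (hcov : ∀ j h, ∃ a ∈ N j, ∑ k, (v h k - v a k) ^ 2 ≤ W * (1 / 4) ^ j)
    (g : (ι → Bool) → V) (l : ℝ) :
    ∑ σ : ι → Bool, Real.exp (l * ∑ k, sgn (σ k) * v (g σ) k) ≤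
      2 ^ Fintype.card ι * Real.exp (4 * D + 20 * l ^ 2 * W) := by
  classical
  choose π hπN hπ using hcov
  -- The filters keep only short links and discard none that is used: through the common point `g
  -- σ`, a link has squared length at most $2W4^{-(i+1)}+2W4^{-i}=10W4^{-(i+1)}$.
  let Λ : ℕ → Finset (ι → ℝ) := fun i => Nat.casesOn i
    (((N 0).image v).filter fun u => ∑ k, u k ^ 2 ≤ 10 * W * (1 / 4) ^ 0)
    (fun i => ((N (i + 1) ×ˢ N i).image fun p => v p.1 - v p.2).filter
      fun u => ∑ k, u k ^ 2 ≤ 10 * W * (1 / 4) ^ (i + 1))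
  let w : (ι → Bool) → ℕ → ι → ℝ := fun σ i => Nat.casesOn i
    (v (π 0 (g σ))) (fun i => v (π (i + 1) (g σ)) - v (π i (g σ)))
  have hpos : ∀ i (σ : ι → Bool), 1 ≤ (N i).card := fun i σ => Finset.card_pos.2 ⟨_, hπN i (g σ)⟩
  have hne : Nonempty (ι → Bool) := ⟨fun _ => true⟩
  obtain ⟨σ₀⟩ := hne
  have hlogle : ∀ {a b : ℕ}, 1 ≤ b → a ≤ b → Real.log a ≤ Real.log b := by
    intro a b hb hab
    rcases Nat.eq_zero_or_pos a with rfl | ha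
    · simpa using Real.log_natCast_nonneg b
    · exact Real.log_le_log (by exact_mod_cast ha) (by exact_mod_cast hab)
  have hΛcard : ∀ i, Real.log (Λ i).card ≤ 2 * D * (i + 1) := by
    intro i
    cases i with
    | zero =>
      have h1 : (Λ 0).card ≤ (N 0).card := (Finset.card_filter_le _ _).trans Finset.card_image_le
      have h2 := hcard 0
      have h3 := hlogle (hpos 0 σ₀) h1
      push_cast at h2 ⊢
      linarith
    | succ i =>
      have h1 : (Λ (i + 1)).card ≤ (N (i + 1)).card * (N i).card := by
        rw [← Finset.card_product]
        exact (Finset.card_filter_le _ _).trans Finset.card_image_le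
      have p1 := hpos (i + 1) σ₀
      have p2 := hpos i σ₀
      have h3 := hlogle (Nat.one_le_iff_ne_zero.2 (by positivity)) h1
      push_cast at h3
      rw [Real.log_mul (by positivity) (by positivity)] at h3
      have h4 := hcard (i + 1)
      have h5 := hcard i
      push_cast at h4 ⊢
      linarith
  have hΛW : ∀ i, ∀ u ∈ Λ i, ∑ k, u k ^ 2 ≤ 10 * W * (1 / 4) ^ i := by
    intro i u hu
    cases i with
    | zero => exact (Finset.mem_filter.1 hu).2
    | succ i => exact (Finset.mem_filter.1 hu).2
  have hw : ∀ σ i, w σ i ∈ Λ i := by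
    intro σ i
    cases i with
    | zero =>
      refine Finset.mem_filter.2 ⟨Finset.mem_image.2 ⟨_, hπN 0 (g σ), rfl⟩, ?_⟩
      have := hW (π 0 (g σ))
      change ∑ k, v (π 0 (g σ)) k ^ 2 ≤ _
      simp only [pow_zero, mul_one]
      linarith
    | succ i =>
      refine Finset.mem_filter.2 ⟨Finset.mem_image.2
        ⟨(π (i + 1) (g σ), π i (g σ)), Finset.mem_product.2 ⟨hπN _ _, hπN _ _⟩, rfl⟩, ?_⟩
      have h1 := hπ (i + 1) (g σ)
      have h2 := hπ i (g σ)
      have h3 : ∑ k, (v (π (i + 1) (g σ)) - v (π i (g σ))) k ^ 2 ≤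
          2 * ∑ k, (v (g σ) k - v (π (i + 1) (g σ)) k) ^ 2 +
          2 * ∑ k, (v (g σ) k - v (π i (g σ)) k) ^ 2 := by
        rw [Finset.mul_sum, Finset.mul_sum, ← Finset.sum_add_distrib]
        refine Finset.sum_le_sum fun k _ => ?_
        simp only [Pi.sub_apply]
        nlinarith [sq_nonneg ((v (g σ) k - v (π (i + 1) (g σ)) k) +
          (v (g σ) k - v (π i (g σ)) k))]
      refine h3.trans ?_
      rw [pow_succ] at h1 ⊢
      linarith
  have htel : ∀ (J : ℕ) σ, ∑ i ∈ Finset.range (J + 1), ∑ k, sgn (σ k) * w σ i k =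
      ∑ k, sgn (σ k) * v (π J (g σ)) k := by
    intro J σ
    induction J with
    | zero => simp [w]
    | succ J ih =>
      rw [Finset.sum_range_succ, ih, ← Finset.sum_add_distrib]
      exact Finset.sum_congr rfl fun k _ => by simp only [w, Pi.sub_apply]; ring
  have hbound : ∀ J : ℕ, ∑ σ : ι → Bool, Real.exp (l * ∑ k, sgn (σ k) * v (g σ) k) ≤
      2 ^ Fintype.card ι * Real.exp (4 * D + 20 * l ^ 2 * W) *
        Real.exp (|l| * (√(Fintype.card ι * W) * (1 / 2) ^ J)) := by
    intro J
    have hchain := sum_exp_chain_le Λ hD hΛcard hΛW w hw l hW0 (J + 1)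
    refine le_trans ?_ (mul_le_mul_of_nonneg_right hchain (Real.exp_pos _).le)
    rw [Finset.sum_mul]
    refine Finset.sum_le_sum fun σ _ => ?_
    rw [← Real.exp_add]
    refine Real.exp_le_exp.2 ?_
    rw [htel J σ]
    have hrem : |∑ k, sgn (σ k) * v (g σ) k - ∑ k, sgn (σ k) * v (π J (g σ)) k| ≤
        √(Fintype.card ι * W) * (1 / 2) ^ J := by
      rw [← Finset.sum_sub_distrib]
      have h1 : |∑ k, (sgn (σ k) * v (g σ) k - sgn (σ k) * v (π J (g σ)) k)| ≤
          ∑ k, |v (g σ) k - v (π J (g σ)) k| := by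
        refine (Finset.abs_sum_le_sum_abs _ _).trans (Finset.sum_le_sum fun k _ => ?_)
        rw [← mul_sub, abs_mul, abs_sgn, one_mul]
      refine h1.trans ?_
      have h2 := sq_sum_le_card_mul_sum_sq (s := Finset.univ)
        (f := fun k => |v (g σ) k - v (π J (g σ)) k|)
      simp only [sq_abs, Finset.card_univ] at h2
      have h3 : √(Fintype.card ι * W) * (1 / 2) ^ J = √(Fintype.card ι * (W * (1 / 4) ^ J)) := by
        have : (1 / 4 : ℝ) ^ J = ((1 / 2) ^ J) ^ 2 := by rw [← pow_mul, mul_comm, pow_mul]; norm_num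
        rw [this, ← mul_assoc, Real.sqrt_mul (mul_nonneg (Nat.cast_nonneg _) hW0) (((1 / 2) ^ J) ^ 2),
            Real.sqrt_sq (by positivity)]
      rw [h3]
      exact Real.le_sqrt_of_sq_le (h2.trans (mul_le_mul_of_nonneg_left (hπ J (g σ))
        (Nat.cast_nonneg _)))
    have h5 := mul_le_mul_of_nonneg_left hrem (abs_nonneg l)
    rw [← abs_mul] at h5
    linarith [le_abs_self (l * (∑ k, sgn (σ k) * v (g σ) k - ∑ k, sgn (σ k) * v (π J (g σ)) k))]
  -- The chain bound does not depend on its length, so the Cauchy–Schwarz remainder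
  -- $\sqrt{|\iota|W}\,2^{-J}$ can be sent to 0.
  have hlim : Filter.Tendsto (fun J : ℕ => 2 ^ Fintype.card ι * Real.exp (4 * D + 20 * l ^ 2 * W) *
        Real.exp (|l| * (√(Fintype.card ι * W) * (1 / 2) ^ J))) Filter.atTop
      (nhds (2 ^ Fintype.card ι * Real.exp (4 * D + 20 * l ^ 2 * W) *
        Real.exp (|l| * (√(Fintype.card ι * W) * 0)))) := by
    refine Filter.Tendsto.const_mul _ ((Real.continuous_exp.tendsto _).comp
      (Filter.Tendsto.const_mul _ (Filter.Tendsto.const_mul _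
        (tendsto_pow_atTop_nhds_zero_of_lt_one (by norm_num) (by norm_num)))))
  have := ge_of_tendsto' hlim hbound
  simpa using this

/-- Exponential moment of the symmetrized empirical process of a loss class over a class of finite
pseudo-dimension. -/
theorem sum_exp_loss_selector_le {X 𝒵 ι : Type*} [Fintype ι] [DecidableEq ι] [Nonempty ι]
    {H : Set (X → ℝ)} {d : ℕ} (hd : vcDim H ≤ d) {c R : ℝ} (hR : 0 < R) (hrange : ∀ h ∈ H, ∀ x, c ≤ h x ∧ h x ≤ c + R)
    (pr : 𝒵 → X) (f : (X → ℝ) → 𝒵 → ℝ)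
    (hf : ∀ h ∈ H, ∀ ζ, 0 ≤ f h ζ ∧ f h ζ ≤ R ^ 2)
    (hlip : ∀ h ∈ H, ∀ h' ∈ H, ∀ ζ, |f h ζ - f h' ζ| ≤ R * |h (pr ζ) - h' (pr ζ)|)
    (z z' : ι → 𝒵) (g : (ι → Bool) → X → ℝ) (hg : ∀ σ, g σ ∈ H) (l : ℝ) :
    ∑ σ : ι → Bool, Real.exp (l * ∑ k, sgn (σ k) * (f (g σ) (z' k) - f (g σ) (z k))) ≤
      2 ^ Fintype.card ι * Real.exp (20 * d + 80 * l ^ 2 * (R ^ 4 * Fintype.card ι)) := by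
  classical
  -- The cover is taken on both samples together, so one family of centres serves all sign patterns.
  have hcovex := exists_l1_cover (P := ι ⊕ ι) (Sum.elim (pr ∘ z) (pr ∘ z')) hd hR hrange
  choose N hNH hNcard hNcov using hcovex
  have key := sum_exp_selector_le (V := H) (ι := ι)
    (fun h k => f h.1 (z' k) - f h.1 (z k)) (D := 5 * d) (W := 4 * (R ^ 4 * Fintype.card ι))
    (by positivity) (by positivity) ?_ (fun j => (N j).subtype (· ∈ H)) ?_ ?_
    (fun σ => ⟨g σ, hg σ⟩) l
  · refine key.trans_eq ?_
    ring_nf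
  · intro h
    have : ∀ k ∈ Finset.univ, (f h.1 (z' k) - f h.1 (z k)) ^ 2 ≤ R ^ 4 := fun k _ => by
      have h1 := hf h.1 h.2 (z' k)
      have h2 := hf h.1 h.2 (z k)
      have : R ^ 4 = (R ^ 2) ^ 2 := by ring
      rw [this]
      exact sq_le_sq' (by linarith) (by linarith)
    refine (Finset.sum_le_card_nsmul _ _ _ this).trans ?_
    rw [nsmul_eq_mul, Finset.card_univ]
    have : 0 ≤ (Fintype.card ι : ℝ) * R ^ 4 := by positivity
    linarith
  · intro j
    rw [Finset.card_subtype, Finset.filter_true_of_mem fun a ha => hNH j a ha]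
    exact hNcard j
  · intro j h
    obtain ⟨a, ha, hdist⟩ := hNcov j h.1 h.2
    refine ⟨⟨a, hNH j a ha⟩, Finset.mem_subtype.2 ha, ?_⟩
    simp only [Fintype.sum_sum_type, Sum.elim_inl, Sum.elim_inr, Function.comp, Fintype.card_sum]
      at hdist
    -- One factor $|h-a|$ is replaced by the range `R`, so an $L^1$ cover at scale $4^{-j}$ is an
    -- $L^2$ cover of the losses at scale $2^{-j}$, as chaining requires.
    have hsq : ∀ ζ, (f h.1 ζ - f a ζ) ^ 2 ≤ R ^ 3 * |h.1 (pr ζ) - a (pr ζ)| := by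
      intro ζ
      have h1 := hlip h.1 h.2 a (hNH j a ha) ζ
      have h2 := hrange h.1 h.2 (pr ζ)
      have h3 := hrange a (hNH j a ha) (pr ζ)
      have h4 : |h.1 (pr ζ) - a (pr ζ)| ≤ R := abs_le.2 ⟨by linarith, by linarith⟩
      have h5 := abs_nonneg (h.1 (pr ζ) - a (pr ζ))
      calc (f h.1 ζ - f a ζ) ^ 2 = |f h.1 ζ - f a ζ| ^ 2 := (sq_abs _).symm
        _ ≤ (R * |h.1 (pr ζ) - a (pr ζ)|) ^ 2 := pow_le_pow_left₀ (abs_nonneg _) h1 2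
        _ = R ^ 2 * |h.1 (pr ζ) - a (pr ζ)| * |h.1 (pr ζ) - a (pr ζ)| := by ring
        _ ≤ R ^ 2 * |h.1 (pr ζ) - a (pr ζ)| * R :=
            mul_le_mul_of_nonneg_left h4 (by positivity)
        _ = _ := by ring
    have hk : ∀ k ∈ Finset.univ, (f h.1 (z' k) - f h.1 (z k) - (f a (z' k) - f a (z k))) ^ 2 ≤
        2 * R ^ 3 * (|h.1 (pr (z k)) - a (pr (z k))| + |h.1 (pr (z' k)) - a (pr (z' k))|) := by
      intro k _
      have h1 := hsq (z k)
      have h2 := hsq (z' k)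
      nlinarith [sq_nonneg ((f h.1 (z' k) - f a (z' k)) + (f h.1 (z k) - f a (z k)))]
    refine (Finset.sum_le_sum hk).trans ?_
    rw [← Finset.mul_sum, Finset.sum_add_distrib]
    refine (mul_le_mul_of_nonneg_left hdist (by positivity)).trans_eq ?_
    push_cast
    ring

/-! ### Symmetrization and tail bound -/

/-- Both entries of a pair have the same law, so each pair may be swapped separately; the laws of
different coordinates may differ. -/
theorem measurePreserving_swap_coord {𝒵 ι : Type*} [MeasurableSpace 𝒵] [Fintype ι]
    (P : ι → Measure 𝒵) [∀ k, IsProbabilityMeasure (P k)] (σ : ι → Bool) :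
    MeasurePreserving (fun x : ι → 𝒵 × 𝒵 => fun k => if σ k then x k else (x k).swap)
      (Measure.pi fun k => (P k).prod (P k)) (Measure.pi fun k => (P k).prod (P k)) := by
  refine measurePreserving_pi (f := fun k (y : 𝒵 × 𝒵) => if σ k then y else y.swap) _ _ fun k => ?_
  cases σ k
  · simpa using (Measure.measurePreserving_swap (μ := P k) (ν := P k))
  · simpa using! MeasurePreserving.id _

/-- Averaging an integral over a pair of independent samples over all coordinate swaps. -/
theorem lintegral_prod_pi_le_of_swap {𝒵 ι : Type*} [MeasurableSpace 𝒵] [Fintype ι] [DecidableEq ι]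
    (P : ι → Measure 𝒵) [∀ k, IsProbabilityMeasure (P k)]
    {G : (ι → 𝒵) × (ι → 𝒵) → ℝ≥0∞} (hG : Measurable G) {M : ℝ}
    (hswap : ∀ z z' : ι → 𝒵, ∑ σ : ι → Bool,
      G (fun k => if σ k then z k else z' k, fun k => if σ k then z' k else z k) ≤
        ENNReal.ofReal (2 ^ Fintype.card ι * M)) :
    ∫⁻ p, G p ∂((Measure.pi P).prod (Measure.pi P)) ≤ ENNReal.ofReal M := by
  have he := measurePreserving_arrowProdEquivProdArrow 𝒵 𝒵 ι P P
  rw [← he.lintegral_comp hG]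
  have hinv : ∀ σ : ι → Bool,
      ∫⁻ x : ι → 𝒵 × 𝒵, G (fun k => if σ k then (x k).1 else (x k).2,
        fun k => if σ k then (x k).2 else (x k).1) ∂(Measure.pi fun k => (P k).prod (P k)) =
      ∫⁻ x, G (MeasurableEquiv.arrowProdEquivProdArrow 𝒵 𝒵 ι x)
        ∂(Measure.pi fun k => (P k).prod (P k)) := by
    intro σ
    refine Eq.trans (lintegral_congr fun x => ?_)
      ((measurePreserving_swap_coord P σ).lintegral_comp (hG.comp he.measurable))
    congr 1
    refine Prod.ext (funext fun k => ?_) (funext fun k => ?_) <;>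
    · simp only [MeasurableEquiv.arrowProdEquivProdArrow, Equiv.arrowProdEquivProdArrow,
        MeasurableEquiv.coe_mk, Equiv.coe_fn_mk]
      cases σ k <;> simp
  have hmeas : ∀ σ : ι → Bool, Measurable fun x : ι → 𝒵 × 𝒵 =>
      G (fun k => if σ k then (x k).1 else (x k).2, fun k => if σ k then (x k).2 else (x k).1) := by
    intro σ
    refine hG.comp (Measurable.prodMk (measurable_pi_lambda _ fun k => ?_)
      (measurable_pi_lambda _ fun k => ?_)) <;> cases σ k <;> simp <;> fun_prop
  have hsum : (2 ^ Fintype.card ι : ℝ≥0∞) *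
      ∫⁻ x, G (MeasurableEquiv.arrowProdEquivProdArrow 𝒵 𝒵 ι x)
        ∂(Measure.pi fun k => (P k).prod (P k)) ≤ 2 ^ Fintype.card ι * ENNReal.ofReal M := by
    calc _ = ∑ σ : ι → Bool, ∫⁻ x : ι → 𝒵 × 𝒵, G (fun k => if σ k then (x k).1 else (x k).2,
        fun k => if σ k then (x k).2 else (x k).1) ∂(Measure.pi fun k => (P k).prod (P k)) := by
          simp only [hinv, Finset.sum_const, Finset.card_univ, Fintype.card_fun,
            Fintype.card_bool, nsmul_eq_mul]
          push_cast
          rfl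
      _ = ∫⁻ x : ι → 𝒵 × 𝒵, ∑ σ : ι → Bool, G (fun k => if σ k then (x k).1 else (x k).2,
        fun k => if σ k then (x k).2 else (x k).1) ∂(Measure.pi fun k => (P k).prod (P k)) :=
          (lintegral_finsetSum _ fun σ _ => hmeas σ).symm
      _ ≤ ∫⁻ _x : ι → 𝒵 × 𝒵, ENNReal.ofReal (2 ^ Fintype.card ι * M)
          ∂(Measure.pi fun k => (P k).prod (P k)) :=
          lintegral_mono fun x => hswap (fun k => (x k).1) (fun k => (x k).2)
      _ = 2 ^ Fintype.card ι * ENNReal.ofReal M := by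
          rw [lintegral_const, measure_univ, mul_one, ENNReal.ofReal_mul (by positivity),
            ENNReal.ofReal_pow (by norm_num)]
          simp
  exact (ENNReal.mul_le_mul_iff_right (by simp) (by simp)).1 hsum

theorem ofReal_exp_le_lintegral {Ω : Type*} [MeasurableSpace Ω] (μ : Measure Ω)
    [IsProbabilityMeasure μ] {Y : Ω → ℝ} (hY : Measurable Y) {b : ℝ} (hb : ∀ ω, |Y ω| ≤ b) :
    ENNReal.ofReal (Real.exp (∫ ω, Y ω ∂μ)) ≤ ∫⁻ ω, ENNReal.ofReal (Real.exp (Y ω)) ∂μ := by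
  have hint : Integrable Y μ := Integrable.of_bound hY.aestronglyMeasurable b (ae_of_all _ hb)
  have hexp : Integrable (fun ω => Real.exp (Y ω)) μ :=
    Integrable.of_bound (Real.measurable_exp.comp hY).aestronglyMeasurable (Real.exp b)
      (ae_of_all _ fun ω => by
        rw [Real.norm_eq_abs, Real.abs_exp]
        exact Real.exp_le_exp.2 ((le_abs_self _).trans (hb ω)))
  rw [← ofReal_integral_eq_lintegral_ofReal hexp (ae_of_all _ fun ω => (Real.exp_pos _).le)]
  refine ENNReal.ofReal_le_ofReal ?_
  exact convexOn_exp.map_integral_le Real.continuous_exp.continuousOn isClosed_univ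
    (ae_of_all _ fun _ => Set.mem_univ _) hint hexp

/-- Symmetrization of the exponential moment of the deviation of a data-dependent function `f p`,
which may use auxiliary data `p.2` with an arbitrary dependence on the sample `p.1`. -/
theorem lintegral_exp_deviation_le {𝒵 A ι : Type*} [MeasurableSpace 𝒵] [MeasurableSpace A]
    [StandardBorelSpace A] [Nonempty A] [Fintype ι] [DecidableEq ι]
    (P : ι → Measure 𝒵) [∀ k, IsProbabilityMeasure (P k)]
    (ρ : Measure ((ι → 𝒵) × A)) [IsFiniteMeasure ρ] (hρ : ρ.fst = Measure.pi P)
    (f : (ι → 𝒵) × A → 𝒵 → ℝ) (hf : Measurable fun p : ((ι → 𝒵) × A) × 𝒵 => f p.1 p.2)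
    {b : ℝ} (hb : ∀ p ζ, |f p ζ| ≤ b) (l : ℝ) {M : ℝ}
    (hrad : ∀ (z z' : ι → 𝒵) (q : (ι → Bool) → (ι → 𝒵) × A), ∑ σ : ι → Bool,
      Real.exp (l * ∑ k, sgn (σ k) * (f (q σ) (z' k) - f (q σ) (z k))) ≤
        2 ^ Fintype.card ι * M) :
    ∫⁻ p, ENNReal.ofReal (Real.exp (l * (∑ k, ∫ ζ, f p ζ ∂(P k) - ∑ k, f p (p.1 k)))) ∂ρ ≤
      ENNReal.ofReal M := by
  have hfp : ∀ p, Measurable (f p) := fun p => hf.comp measurable_prodMk_left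
  obtain ⟨E, hE⟩ : ∃ E : ((ι → 𝒵) × A) → (ι → 𝒵) → ℝ≥0∞, ∀ p z', E p z' =
    ENNReal.ofReal (Real.exp (l * (∑ k, f p (z' k) - ∑ k, f p (p.1 k)))) := ⟨_, fun _ _ => rfl⟩
  have hEm : Measurable fun q : ((ι → 𝒵) × A) × (ι → 𝒵) => E q.1 q.2 := by
    simp only [hE]
    refine ENNReal.measurable_ofReal.comp (Real.measurable_exp.comp (Measurable.const_mul
      (Measurable.sub (Finset.measurable_sum _ fun k _ => ?_)
        (Finset.measurable_sum _ fun k _ => ?_)) _))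
    · exact hf.comp (f := fun q : ((ι → 𝒵) × A) × (ι → 𝒵) => (q.1, q.2 k)) (by fun_prop)
    · exact hf.comp (f := fun q : ((ι → 𝒵) × A) × (ι → 𝒵) => (q.1, q.1.1 k)) (by fun_prop)
  have hbound : ∀ p (z' : ι → 𝒵), |l * (∑ k, f p (z' k) - ∑ k, f p (p.1 k))| ≤
      |l| * (Fintype.card ι * b + Fintype.card ι * b) := by
    intro p z'
    rw [abs_mul]
    have hs : ∀ y : ι → 𝒵, |∑ k, f p (y k)| ≤ Fintype.card ι * b := fun y => by
      refine (Finset.abs_sum_le_sum_abs _ _).trans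
        ((Finset.sum_le_card_nsmul _ _ b fun k _ => hb p (y k)).trans_eq ?_)
      rw [nsmul_eq_mul, Finset.card_univ]
    exact mul_le_mul_of_nonneg_left ((abs_sub _ _).trans (add_le_add (hs _) (hs _)))
      (abs_nonneg l)
  -- The means are replaced by an independent ghost sample `z'`, by Jensen's inequality with `p`
  -- held fixed.
  have hjensen : ∀ p, ENNReal.ofReal
      (Real.exp (l * (∑ k, ∫ ζ, f p ζ ∂(P k) - ∑ k, f p (p.1 k)))) ≤
      ∫⁻ z', E p z' ∂(Measure.pi P) := by
    intro p
    have hint : ∀ k, Integrable (fun z' : ι → 𝒵 => f p (z' k)) (Measure.pi P) := fun k =>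
      Integrable.of_bound ((hfp p).comp (measurable_pi_apply k)).aestronglyMeasurable b
        (ae_of_all _ fun z' => hb _ _)
    have hmean : ∫ z', l * (∑ k, f p (z' k) - ∑ k, f p (p.1 k)) ∂(Measure.pi P) =
        l * (∑ k, ∫ ζ, f p ζ ∂(P k) - ∑ k, f p (p.1 k)) := by
      rw [integral_const_mul, integral_sub (integrable_finsetSum _ fun k _ => hint k)
        (integrable_const _), integral_finsetSum _ fun k _ => hint k, integral_const]
      have h1 : ∀ k, ∫ z' : ι → 𝒵, f p (z' k) ∂(Measure.pi P) = ∫ ζ, f p ζ ∂(P k) := fun k => by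
        rw [← (measurePreserving_eval P k).map_eq,
          integral_map (measurable_pi_apply k).aemeasurable (hfp p).aestronglyMeasurable]
      simp [h1]
    rw [← hmean]
    simp only [hE]
    refine ofReal_exp_le_lintegral _ ?_
      (b := |l| * (Fintype.card ι * b + Fintype.card ι * b)) fun z' => ?_
    · exact Measurable.const_mul (Measurable.sub_const (Finset.measurable_sum _ fun k _ =>
        (hfp p).comp (measurable_pi_apply k)) _) _
    · exact hbound p z'
  -- Disintegration: once the auxiliary data are integrated out given the sample, the integrand
  -- depends on the two independent samples only and can be swapped.
  set κ := ρ.condKernel with hκ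
  have hstep : ∫⁻ p, ∫⁻ z', E p z' ∂(Measure.pi P) ∂ρ =
      ∫⁻ y, ∫⁻ a, E (y.1, a) y.2 ∂(κ y.1) ∂((Measure.pi P).prod (Measure.pi P)) := by
    have hm1 : Measurable fun p => ∫⁻ z', E p z' ∂(Measure.pi P) := hEm.lintegral_prod_right'
    have hm2 : Measurable fun y : (ι → 𝒵) × (ι → 𝒵) => ∫⁻ a, E (y.1, a) y.2 ∂(κ y.1) := by
      have h : Measurable fun q : ((ι → 𝒵) × (ι → 𝒵)) × A => E (q.1.1, q.2) q.1.2 :=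
        hEm.comp (f := fun q : ((ι → 𝒵) × (ι → 𝒵)) × A => ((q.1.1, q.2), q.1.2)) (by fun_prop)
      exact h.lintegral_kernel_prod_right' (κ := κ.comap Prod.fst measurable_fst)
    rw [lintegral_prod _ hm2.aemeasurable]
    conv_lhs => rw [← ρ.disintegrate κ]
    rw [Measure.lintegral_compProd hm1, hρ]
    refine lintegral_congr fun z => ?_
    refine lintegral_lintegral_swap (f := fun a z' => E (z, a) z') ?_
    exact (hEm.comp (f := fun q : A × (ι → 𝒵) => ((z, q.1), q.2)) (by fun_prop)).aemeasurable
  refine (lintegral_mono hjensen).trans ?_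
  rw [hstep]
  refine lintegral_prod_pi_le_of_swap P ?_ fun z z' => ?_
  · have h : Measurable fun q : ((ι → 𝒵) × (ι → 𝒵)) × A => E (q.1.1, q.2) q.1.2 :=
      hEm.comp (f := fun q : ((ι → 𝒵) × (ι → 𝒵)) × A => ((q.1.1, q.2), q.1.2)) (by fun_prop)
    exact h.lintegral_kernel_prod_right' (κ := κ.comap Prod.fst measurable_fst)
  -- After a swap the auxiliary data follow the kernel at the swapped sample. For each `σ` some
  -- value does at least as well as the average; these values form the selector for `hrad`.
  · have hsel : ∀ σ : ι → Bool, ∃ a : A,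
        ∫⁻ a, E (fun k => if σ k then z k else z' k, a) (fun k => if σ k then z' k else z k)
          ∂(κ fun k => if σ k then z k else z' k) ≤
        E (fun k => if σ k then z k else z' k, a) (fun k => if σ k then z' k else z k) := by
      intro σ
      have hle : ∀ p z', E p z' ≤
          ENNReal.ofReal (Real.exp (|l| * (Fintype.card ι * b + Fintype.card ι * b))) := by
        intro p z'
        rw [hE]
        exact ENNReal.ofReal_le_ofReal (Real.exp_le_exp.2 ((le_abs_self _).trans (hbound _ _)))
      refine exists_lintegral_le (ne_top_of_le_ne_top (b := ENNReal.ofReal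
        (Real.exp (|l| * (Fintype.card ι * b + Fintype.card ι * b)))) ENNReal.ofReal_ne_top ?_)
      refine (lintegral_mono fun a => hle _ _).trans_eq ?_
      rw [lintegral_const, measure_univ, mul_one]
    choose a ha using hsel
    refine (Finset.sum_le_sum fun σ _ => ha σ).trans ?_
    simp only [hE]
    rw [← ENNReal.ofReal_sum_of_nonneg fun σ _ => (Real.exp_pos _).le]
    refine ENNReal.ofReal_le_ofReal ?_
    refine le_trans (le_of_eq (Finset.sum_congr rfl fun σ _ => ?_))
      (hrad z z' fun σ => (fun k => if σ k then z k else z' k, a σ))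
    congr 2
    rw [← Finset.sum_sub_distrib]
    refine Finset.sum_congr rfl fun k _ => ?_
    cases σ k <;> simp [sgn]

/-- Tail bound for the deviation of a data-dependent function whose symmetrized process has
sub-Gaussian exponential moments. -/
theorem measure_deviation_le {Ω 𝒵 A ι : Type*} [MeasurableSpace Ω] [MeasurableSpace 𝒵]
    [MeasurableSpace A] [StandardBorelSpace A] [Nonempty A] [Fintype ι] [DecidableEq ι] [Nonempty ι]
    (μ : Measure Ω) [IsProbabilityMeasure μ] (Z : ι → Ω → 𝒵) (hZ : ∀ k, Measurable (Z k))
    (hind : iIndepFun Z μ) (U : Ω → A) (hU : Measurable U)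
    (f : (ι → 𝒵) × A → 𝒵 → ℝ) (hf : Measurable fun p : ((ι → 𝒵) × A) × 𝒵 => f p.1 p.2)
    {b : ℝ} (hb : ∀ p ζ, |f p ζ| ≤ b) {c d L : ℝ} (hc : 0 ≤ c) (hd : 0 ≤ d) (hL : 0 ≤ L)
    (hrad : ∀ (l : ℝ) (z z' : ι → 𝒵) (q : (ι → Bool) → (ι → 𝒵) × A), ∑ σ : ι → Bool,
      Real.exp (l * ∑ k, sgn (σ k) * (f (q σ) (z' k) - f (q σ) (z k))) ≤
        2 ^ Fintype.card ι * Real.exp (c * (d + l ^ 2 * Fintype.card ι))) :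
    μ {ω | (2 * c + 1) * √((d + L) / Fintype.card ι) < (Fintype.card ι : ℝ)⁻¹ *
      (∑ k, ∫ ζ, f (fun k => Z k ω, U ω) ζ ∂(μ.map (Z k)) -
        ∑ k, f (fun k => Z k ω, U ω) (Z k ω))} ≤ ENNReal.ofReal (Real.exp (-L)) := by
  set m : ℝ := (Fintype.card ι : ℝ) with hm
  have hm0 : 0 < m := by rw [hm]; exact_mod_cast Fintype.card_pos
  have hprob : ∀ k, IsProbabilityMeasure (μ.map (Z k)) := fun k =>
    Measure.isProbabilityMeasure_map (hZ k).aemeasurable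
  -- This value is both the Markov parameter and the unit of the threshold. Since $s^2m=d+L$, the
  -- exponent is $c(2d+L)-(2c+1)(d+L)\le-L$.
  set s := √((d + L) / m) with hs
  have hs0 : 0 ≤ s := Real.sqrt_nonneg _
  have hs2 : s ^ 2 * m = d + L := by
    rw [hs, Real.sq_sqrt (by positivity)]; field_simp
  have hT : Measurable fun ω => ((fun k => Z k ω, U ω) : (ι → 𝒵) × A) :=
    (measurable_pi_lambda _ hZ).prodMk hU
  set ρ := μ.map fun ω => ((fun k => Z k ω, U ω) : (ι → 𝒵) × A) with hρ
  have hfst : ρ.fst = Measure.pi fun k => μ.map (Z k) := by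
    rw [hρ, Measure.fst_map_prodMk hU]
    exact (iIndepFun_iff_map_fun_eq_pi_map fun k => (hZ k).aemeasurable).1 hind
  have : IsProbabilityMeasure ρ := Measure.isProbabilityMeasure_map hT.aemeasurable
  have hmain := lintegral_exp_deviation_le (fun k => μ.map (Z k)) ρ hfst f hf hb s (hrad s)
  have hmeas : Measurable fun p : (ι → 𝒵) × A => ENNReal.ofReal
      (Real.exp (s * (∑ k, ∫ ζ, f p ζ ∂(μ.map (Z k)) - ∑ k, f p (p.1 k)))) := by
    refine ENNReal.measurable_ofReal.comp (Real.measurable_exp.comp (Measurable.const_mul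
      (Measurable.sub (Finset.measurable_sum _ fun k _ => ?_)
        (Finset.measurable_sum _ fun k _ => ?_)) _))
    · exact hf.stronglyMeasurable.integral_prod_right'.measurable
    · exact hf.comp (f := fun p : (ι → 𝒵) × A => (p, p.1 k)) (by fun_prop)
  rw [hρ, lintegral_map hmeas hT] at hmain
  have hmarkov := (mul_meas_ge_le_lintegral (μ := μ) (hmeas.comp hT)
    (ENNReal.ofReal (Real.exp (s * (m * ((2 * c + 1) * s)))))).trans hmain
  have hsub : {ω | (2 * c + 1) * s < m⁻¹ *
      (∑ k, ∫ ζ, f (fun k => Z k ω, U ω) ζ ∂(μ.map (Z k)) -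
        ∑ k, f (fun k => Z k ω, U ω) (Z k ω))} ⊆
      {ω | ENNReal.ofReal (Real.exp (s * (m * ((2 * c + 1) * s)))) ≤
        ((fun p : (ι → 𝒵) × A => ENNReal.ofReal
      (Real.exp (s * (∑ k, ∫ ζ, f p ζ ∂(μ.map (Z k)) - ∑ k, f p (p.1 k))))) ∘
        fun ω => ((fun k => Z k ω, U ω) : (ι → 𝒵) × A)) ω} := by
    intro ω hω
    refine ENNReal.ofReal_le_ofReal (Real.exp_le_exp.2 (mul_le_mul_of_nonneg_left ?_ hs0))
    exact (lt_inv_mul_iff₀ hm0).1 hω |>.le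
  refine (measure_mono hsub).trans ?_
  have hexp : 0 < Real.exp (s * (m * ((2 * c + 1) * s))) := Real.exp_pos _
  rw [mul_comm] at hmarkov
  refine ((ENNReal.le_div_iff_mul_le (Or.inl (ENNReal.ofReal_pos.2 hexp).ne')
    (Or.inl ENNReal.ofReal_ne_top)).2 hmarkov).trans ?_
  rw [← ENNReal.ofReal_div_of_pos hexp, ← Real.exp_sub]
  refine ENNReal.ofReal_le_ofReal (Real.exp_le_exp.2 ?_)
  have : s * (m * ((2 * c + 1) * s)) = (2 * c + 1) * (d + L) := by rw [← hs2]; ring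
  rw [this, hs2]
  nlinarith [mul_nonneg hc hL]

/-! ### Good events and change of distribution -/

/-- The complement of a measurable hull works, so the bad set itself need not be measurable. -/
theorem exists_measurableSet_of_measure_le {Ω : Type*} [MeasurableSpace Ω] (μ : Measure Ω)
    [IsProbabilityMeasure μ] {bad : Set Ω} {δ : ℝ} (hδ : 0 ≤ δ)
    (hbad : μ bad ≤ ENNReal.ofReal δ) :
    ∃ E : Set Ω, MeasurableSet E ∧ ENNReal.ofReal (1 - δ) ≤ μ E ∧ ∀ ω ∈ E, ω ∉ bad := by
  refine ⟨(toMeasurable μ bad)ᶜ, (measurableSet_toMeasurable _ _).compl, ?_,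
    fun ω hω hb => hω (subset_toMeasurable _ _ hb)⟩
  rw [prob_compl_eq_one_sub (measurableSet_toMeasurable _ _), measure_toMeasurable,
    ENNReal.ofReal_sub _ hδ, ENNReal.ofReal_one]
  exact tsub_le_tsub_left hbad 1

/-- In terms of densities, $qf\le pf+B|p-q|$ holds pointwise because $0\le f\le B$. -/
theorem integral_le_integral_add_l1Dist {𝒵 : Type*} [MeasurableSpace 𝒵] (P Q : Measure 𝒵)
    [IsFiniteMeasure P] [IsFiniteMeasure Q] {f : 𝒵 → ℝ} (hf : Measurable f) {B : ℝ}
    (hf0 : ∀ ζ, 0 ≤ f ζ) (hfB : ∀ ζ, f ζ ≤ B) :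
    ∫ ζ, f ζ ∂Q ≤ ∫ ζ, f ζ ∂P + B * l1Dist P Q := by
  have hP : P ≪ P + Q := (Measure.le_add_right le_rfl).absolutelyContinuous
  have hQ : Q ≪ P + Q := (Measure.le_add_left le_rfl).absolutelyContinuous
  have hint : ∀ ν : Measure 𝒵, IsFiniteMeasure ν → Integrable f ν := fun ν _ =>
    Integrable.of_bound hf.aestronglyMeasurable B
      (ae_of_all _ fun ζ => by rw [Real.norm_eq_abs, abs_of_nonneg (hf0 ζ)]; exact hfB ζ)
  have iP : Integrable (fun ζ => (P.rnDeriv (P + Q) ζ).toReal • f ζ) (P + Q) :=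
    (integrable_rnDeriv_smul_iff hP).2 (hint P inferInstance)
  have iQ : Integrable (fun ζ => (Q.rnDeriv (P + Q) ζ).toReal • f ζ) (P + Q) :=
    (integrable_rnDeriv_smul_iff hQ).2 (hint Q inferInstance)
  have iabs : Integrable (fun ζ => |(P.rnDeriv (P + Q) ζ).toReal - (Q.rnDeriv (P + Q) ζ).toReal|)
      (P + Q) := (Measure.integrable_toReal_rnDeriv.sub Measure.integrable_toReal_rnDeriv).abs
  rw [← integral_rnDeriv_smul hP, ← integral_rnDeriv_smul hQ, l1Dist, ← integral_const_mul,
    ← integral_add iP (iabs.const_mul B)]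
  refine integral_mono iQ (iP.add (iabs.const_mul B)) fun ζ => ?_
  simp only [smul_eq_mul]
  have h1 := neg_le_abs ((P.rnDeriv (P + Q) ζ).toReal - (Q.rnDeriv (P + Q) ζ).toReal)
  have h2 := abs_nonneg ((P.rnDeriv (P + Q) ζ).toReal - (Q.rnDeriv (P + Q) ζ).toReal)
  nlinarith [mul_le_mul_of_nonneg_left (hfB ζ) h2, mul_le_mul_of_nonneg_right h1 (hf0 ζ)]

theorem integral_avgDist {ι 𝒵 : Type*} [Fintype ι] [MeasurableSpace 𝒵] (P : ι → Measure 𝒵)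
    {f : 𝒵 → ℝ} (hf : ∀ j, Integrable f (P j)) :
    ∫ ζ, f ζ ∂(avgDist P) = (Fintype.card ι : ℝ)⁻¹ * ∑ j, ∫ ζ, f ζ ∂(P j) := by
  rw [avgDist, integral_smul_measure, integral_finsetSum_measure fun j _ => hf j]
  simp

theorem isFiniteMeasure_avgDist {ι 𝒵 : Type*} [Fintype ι] [Nonempty ι] [MeasurableSpace 𝒵]
    (P : ι → Measure 𝒵) [∀ j, IsProbabilityMeasure (P j)] : IsFiniteMeasure (avgDist P) := by
  refine ⟨?_⟩
  simp only [avgDist, Measure.smul_apply, Measure.finsetSum_apply, measure_univ, smul_eq_mul,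
    Finset.sum_const, Finset.card_univ, nsmul_eq_mul, mul_one]
  exact ENNReal.mul_lt_top (by simp [Fintype.card_pos]) (by simp)

/-! ### The two losses -/

theorem measurable_sqHinge : Measurable fun p : ℝ × ℝ => sqHinge p.1 p.2 := by
  unfold sqHinge; fun_prop

theorem measurable_sqError : Measurable fun p : ℝ × ℝ => sqError p.1 p.2 := by
  unfold sqError; fun_prop

/-- The hinge is convex in the prediction; then $(s+t)^2\le2s^2+2t^2$ produces the squared weights.
-/
theorem sqHinge_mix_le {α u w y : ℝ} (h0 : 0 ≤ α) (h1 : α ≤ 1) :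
    sqHinge (α * u + (1 - α) * w) y ≤ 2 * α ^ 2 * sqHinge u y + 2 * (1 - α) ^ 2 * sqHinge w y := by
  unfold sqHinge
  set p := max 0 (1 - y * u) with hp
  set q := max 0 (1 - y * w) with hq
  have hp0 : 0 ≤ p := le_max_left _ _
  have hq0 : 0 ≤ q := le_max_left _ _
  have hp1 : 1 - y * u ≤ p := le_max_right _ _
  have hq1 : 1 - y * w ≤ q := le_max_right _ _
  have hle : max 0 (1 - y * (α * u + (1 - α) * w)) ≤ α * p + (1 - α) * q := by
    refine max_le (by nlinarith) ?_
    nlinarith [mul_le_mul_of_nonneg_left hp1 h0,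
      mul_le_mul_of_nonneg_left hq1 (sub_nonneg.2 h1)]
  calc _ ≤ (α * p + (1 - α) * q) ^ 2 := pow_le_pow_left₀ (le_max_left _ _) hle 2
    _ ≤ _ := by nlinarith [sq_nonneg (α * p - (1 - α) * q)]

theorem sqError_mix_le {α u w y : ℝ} :
    sqError (α * u + (1 - α) * w) y ≤ 2 * α ^ 2 * sqError u y + 2 * (1 - α) ^ 2 * sqError w y := by
  unfold sqError
  nlinarith [sq_nonneg (α * (u - y) - (1 - α) * (w - y))]

/-- A bounded square has a Lipschitz constant governed by its bound. This supplies a constant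
depending on `B` alone for the deviation bounds, in place of `G`. -/
theorem abs_sq_sub_sq_le {p q B : ℝ} (hp : p ^ 2 ≤ B) (hq : q ^ 2 ≤ B) :
    |p ^ 2 - q ^ 2| ≤ 2 * √B * |p - q| := by
  have h1 := Real.abs_le_sqrt hp
  have h2 := Real.abs_le_sqrt hq
  rw [sq_sub_sq, abs_mul]
  exact mul_le_mul_of_nonneg_right ((abs_add_le p q).trans (by linarith)) (abs_nonneg _)

theorem abs_sqHinge_sub_le {u w y B : ℝ} (hy : |y| = 1) (hu : sqHinge u y ≤ B)
    (hw : sqHinge w y ≤ B) : |sqHinge u y - sqHinge w y| ≤ 2 * √B * |u - w| := by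
  refine (abs_sq_sub_sq_le hu hw).trans (mul_le_mul_of_nonneg_left ?_ (by positivity))
  refine (abs_max_sub_max_le_max _ _ _ _).trans ?_
  have : 1 - y * u - (1 - y * w) = y * (w - u) := by ring
  rw [sub_self, abs_zero, this, abs_mul, hy, one_mul, abs_sub_comm]
  simp

theorem abs_sqError_sub_le {u w y B : ℝ} (hu : sqError u y ≤ B)
    (hw : sqError w y ≤ B) : |sqError u y - sqError w y| ≤ 2 * √B * |u - w| := by
  refine (abs_sq_sub_sq_le hu hw).trans_eq ?_
  rw [sub_sub_sub_cancel_right]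

/-- A prediction with bounded squared hinge loss at both labels lies in a short interval. -/
theorem sqHinge_range {u B : ℝ} (h1 : sqHinge u 1 ≤ B) (h2 : sqHinge u (-1) ≤ B) :
    -√B ≤ u ∧ u ≤ √B := by
  have e1 := (le_max_right 0 (1 - 1 * u)).trans ((le_abs_self _).trans (Real.abs_le_sqrt h1))
  have e2 := (le_max_right 0 (1 - -1 * u)).trans ((le_abs_self _).trans (Real.abs_le_sqrt h2))
  constructor <;> linarith

theorem sqError_range {u y B : ℝ} (h : sqError u y ≤ B) : y - √B ≤ u ∧ u ≤ y + √B := by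
  have := abs_le.1 (Real.abs_le_sqrt h)
  constructor <;> linarith

/-! ### Dimension zero, disagreement and the optimal weight -/

/-- If $h(x)<h'(x)$, the point $(x,h(x))$ lies under `h'` but not under `h`, hence is a shattered
singleton. -/
theorem subsingleton_of_vcDim_eq_zero {X : Type*} {H : Set (X → ℝ)} (hd : vcDim H ≤ 0) :
    H.Subsingleton := by
  have key : ∀ h ∈ H, ∀ h' ∈ H, ∀ x, ¬h x < h' x := by
    intro h hh h' hh' x hlt
    have hs : Shatters (subgraph '' H) {(x, h x)} := by
      intro t ht
      rcases Finset.subset_singleton_iff.1 ht with rfl | rfl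
      · exact ⟨subgraph h, ⟨h, hh, rfl⟩, by simp [subgraph]⟩
      · exact ⟨subgraph h', ⟨h', hh', rfl⟩, by simpa [subgraph] using hlt⟩
    have := hs.card_le_of_vcDimSets_le (d := 0) hd
    simp at this
  intro h hh h' hh'
  funext x
  exact le_antisymm (not_lt.1 (key h' hh' h hh x)) (not_lt.1 (key h hh h' hh' x))

theorem empRisk_le_add_disagreement {X ι : Type*} {Y : Set ℝ} [Fintype ι] {ℓ : ℝ → ℝ → ℝ}
    {H : Set (X → ℝ)} {c R G : ℝ} (hrange : ∀ h ∈ H, ∀ x, c ≤ h x ∧ h x ≤ c + R) (hG : 0 ≤ G)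
    (hlip : ∀ h ∈ H, ∀ h' ∈ H, ∀ x : X, ∀ y ∈ Y, |ℓ (h x) y - ℓ (h' x) y| ≤ G * |h x - h' x|)
    (s : ι → X × Y) {h h' : X → ℝ} (hh : h ∈ H) (hh' : h' ∈ H) :
    empRisk ℓ s h ≤ empRisk ℓ s h' + G * disagreement H s := by
  -- An unbounded real supremum would take the default value 0; the common range of the class rules
  -- this out.
  have hbdd : BddAbove (Set.range fun p : H × H =>
      (Fintype.card ι : ℝ)⁻¹ * ∑ k, |p.1.1 (s k).1 - p.2.1 (s k).1|) := by
    refine ⟨(Fintype.card ι : ℝ)⁻¹ * ∑ _k : ι, R, ?_⟩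
    rintro _ ⟨p, rfl⟩
    refine mul_le_mul_of_nonneg_left (Finset.sum_le_sum fun k _ => ?_) (by positivity)
    have h1 := hrange _ p.1.2 (s k).1
    have h2 := hrange _ p.2.2 (s k).1
    exact abs_le.2 ⟨by linarith, by linarith⟩
  have hle : (Fintype.card ι : ℝ)⁻¹ * ∑ k, |h (s k).1 - h' (s k).1| ≤ disagreement H s :=
    le_ciSup hbdd (⟨h, hh⟩, ⟨h', hh'⟩)
  have hsum : ∑ k, ℓ (h (s k).1) ((s k).2 : ℝ) ≤
      ∑ k, ℓ (h' (s k).1) ((s k).2 : ℝ) + G * ∑ k, |h (s k).1 - h' (s k).1| := by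
    rw [Finset.mul_sum, ← Finset.sum_add_distrib]
    refine Finset.sum_le_sum fun k _ => ?_
    have := (le_abs_self _).trans (hlip h hh h' hh' (s k).1 (s k).2 (s k).2.2)
    linarith
  have h3 := mul_le_mul_of_nonneg_left hsum (show 0 ≤ (Fintype.card ι : ℝ)⁻¹ by positivity)
  have h4 := mul_le_mul_of_nonneg_left hle hG
  unfold empRisk
  rw [mul_add] at h3
  have h5 : (Fintype.card ι : ℝ)⁻¹ * (G * ∑ k, |h (s k).1 - h' (s k).1|) =
    G * ((Fintype.card ι : ℝ)⁻¹ * ∑ k, |h (s k).1 - h' (s k).1|) := by ring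
  linarith

/-- The minimizer of `β ↦ 2 (1 - β)² a + 2 β² b` for positive `a`, `b`. -/
theorem quadratic_weight_minimizer {a b : ℝ} (ha : 0 < a) (hb : 0 < b) :
    a / (a + b) ∈ Set.Ioo (0 : ℝ) 1 ∧ ∀ β : ℝ, β ≠ a / (a + b) →
      2 * (1 - a / (a + b)) ^ 2 * a + 2 * (a / (a + b)) ^ 2 * b
        < 2 * (1 - β) ^ 2 * a + 2 * β ^ 2 * b := by
  have hab : 0 < a + b := by linarith
  refine ⟨⟨by positivity, by rw [div_lt_one hab]; linarith⟩, fun β hβ => ?_⟩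
  have h1 : 0 < (β - a / (a + b)) ^ 2 := by
    have := sub_ne_zero.2 hβ
    positivity
  have h2 : 2 * (1 - β) ^ 2 * a + 2 * β ^ 2 * b -
      (2 * (1 - a / (a + b)) ^ 2 * a + 2 * (a / (a + b)) ^ 2 * b) =
      2 * (a + b) * (β - a / (a + b)) ^ 2 := by
    field_simp
    ring
  have h3 : 0 < 2 * (a + b) * (β - a / (a + b)) ^ 2 := by positivity
  linarith

/-! ### Risk deviations over the class -/

/-- Deviation of the true from the empirical risk (in the direction `ε = ±1`) at a data-dependent
hypothesis of a class of finite pseudo-dimension. -/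
theorem measure_risk_deviation_le {Ω X A ι : Type*} [MeasurableSpace Ω] [MeasurableSpace X]
    [MeasurableSpace A] [StandardBorelSpace A] [Nonempty A] [Fintype ι] [DecidableEq ι] [Nonempty ι]
    {Y : Set ℝ} {H : Set (X → ℝ)} {d : ℕ} (hd : vcDim H ≤ d) {c R : ℝ} (hR : 0 < R)
    (hrange : ∀ h ∈ H, ∀ x, c ≤ h x ∧ h x ≤ c + R) {ℓ : ℝ → ℝ → ℝ}
    (hℓ : Measurable fun p : ℝ × ℝ => ℓ p.1 p.2)
    (hbd : ∀ h ∈ H, ∀ x : X, ∀ y ∈ Y, 0 ≤ ℓ (h x) y ∧ ℓ (h x) y ≤ R ^ 2)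
    (hlip : ∀ h ∈ H, ∀ h' ∈ H, ∀ x : X, ∀ y ∈ Y, |ℓ (h x) y - ℓ (h' x) y| ≤ R * |h x - h' x|)
    (μ : Measure Ω) [IsProbabilityMeasure μ] (Z : ι → Ω → X × Y) (hZ : ∀ k, Measurable (Z k))
    (hind : iIndepFun Z μ) (U : Ω → A) (hU : Measurable U)
    (h : (ι → X × Y) × A → X → ℝ) (hh : Measurable fun p : ((ι → X × Y) × A) × X => h p.1 p.2)
    (hH : ∀ p, h p ∈ H) {ε : ℝ} (hε : |ε| = 1) {L : ℝ} (hL : 0 ≤ L) :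
    μ {ω | (2 * (20 + 80 * R ^ 4) + 1) * √((d + L) / Fintype.card ι) <
      ε * (risk ℓ (avgDist fun k => μ.map (Z k)) (h (fun k => Z k ω, U ω)) -
        empRisk ℓ (fun k => Z k ω) (h (fun k => Z k ω, U ω)))} ≤
      ENNReal.ofReal (Real.exp (-L)) := by
  have hloss : Measurable fun p : ((ι → X × Y) × A) × (X × Y) =>
      ℓ (h p.1 p.2.1) (p.2.2 : ℝ) := by
    refine hℓ.comp (f := fun p : ((ι → X × Y) × A) × (X × Y) => (h p.1 p.2.1, (p.2.2 : ℝ)))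
      (Measurable.prodMk ?_ (by fun_prop))
    exact hh.comp (f := fun p : ((ι → X × Y) × A) × (X × Y) => (p.1, p.2.1)) (by fun_prop)
  have habs : ∀ p (ζ : X × Y), |ℓ (h p ζ.1) (ζ.2 : ℝ)| ≤ R ^ 2 := fun p ζ => by
    have := hbd _ (hH p) ζ.1 ζ.2 ζ.2.2
    exact abs_le.2 ⟨by linarith [sq_nonneg R], this.2⟩
  have hε2 : ε ^ 2 = 1 := by rw [← sq_abs, hε, one_pow]
  have key := measure_deviation_le μ Z hZ hind U hU
    (fun p ζ => ε * ℓ (h p ζ.1) (ζ.2 : ℝ)) (hloss.const_mul ε) (b := R ^ 2)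
    (fun p ζ => by rw [abs_mul, hε, one_mul]; exact habs p ζ)
    (c := 20 + 80 * R ^ 4) (d := d) (L := L) (by positivity) (by positivity) hL ?_
  · refine le_trans (measure_mono fun ω hω => ?_) key
    rw [Set.mem_ofPred_eq] at hω ⊢
    refine lt_of_lt_of_eq hω ?_
    have hint : ∀ k, Integrable (fun ζ : X × Y => ℓ (h (fun k => Z k ω, U ω) ζ.1) (ζ.2 : ℝ))
        (μ.map (Z k)) := fun k => by
      have := Measure.isProbabilityMeasure_map (μ := μ) (hZ k).aemeasurable
      exact Integrable.of_bound (hloss.comp measurable_prodMk_left).aestronglyMeasurable (R ^ 2)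
        (ae_of_all _ fun ζ => habs _ ζ)
    rw [risk, integral_avgDist _ hint, empRisk]
    simp only [integral_const_mul, ← Finset.mul_sum]
    ring
  · intro l z z' q
    have h1 := sum_exp_loss_selector_le hd hR hrange (Prod.fst : X × Y → X)
      (fun g ζ => ℓ (g ζ.1) (ζ.2 : ℝ)) (fun g hg ζ => hbd g hg ζ.1 ζ.2 ζ.2.2)
      (fun g hg g' hg' ζ => hlip g hg g' hg' ζ.1 ζ.2 ζ.2.2) z z' (fun σ => h (q σ))
      (fun σ => hH _) (l * ε)
    refine le_trans (le_of_eq (Finset.sum_congr rfl fun σ _ => ?_)) (h1.trans ?_)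
    · congr 1
      rw [Finset.mul_sum, Finset.mul_sum]
      exact Finset.sum_congr rfl fun k _ => by ring
    · refine mul_le_mul_of_nonneg_left (Real.exp_le_exp.2 ?_) (by positivity)
      rw [mul_pow, hε2, mul_one]
      have h2 : 0 ≤ 80 * R ^ 4 * (d : ℝ) := by positivity
      have h3 : 0 ≤ 20 * (l ^ 2 * (Fintype.card ι : ℝ)) := by positivity
      nlinarith

theorem avgDist_const {ι 𝒵 : Type*} [Fintype ι] [Nonempty ι] [MeasurableSpace 𝒵]
    (P : Measure 𝒵) : avgDist (fun _ : ι => P) = P := by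
  rw [avgDist, Finset.sum_const, Finset.card_univ, ← Nat.cast_smul_eq_nsmul ℝ≥0∞, smul_smul,
    ENNReal.inv_mul_cancel (by simp) (by simp), one_smul]

theorem measurable_loss_comp {X : Type*} [MeasurableSpace X] {Y : Set ℝ} {ℓ : ℝ → ℝ → ℝ}
    (hℓ : Measurable fun p : ℝ × ℝ => ℓ p.1 p.2) {h : X → ℝ} (hh : Measurable h) :
    Measurable fun ζ : X × Y => ℓ (h ζ.1) (ζ.2 : ℝ) :=
  hℓ.comp (f := fun ζ : X × Y => (h ζ.1, (ζ.2 : ℝ))) (by fun_prop)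

theorem risk_mix_le {X : Type*} [MeasurableSpace X] {Y : Set ℝ} {ℓ : ℝ → ℝ → ℝ}
    (hℓ : Measurable fun p : ℝ × ℝ => ℓ p.1 p.2) (hℓ0 : ∀ u y, 0 ≤ ℓ u y)
    {α B : ℝ} (hmix : ∀ u w y, ℓ (α * u + (1 - α) * w) y ≤
      2 * α ^ 2 * ℓ u y + 2 * (1 - α) ^ 2 * ℓ w y)
    (D : Measure (X × Y)) [IsFiniteMeasure D] {h g : X → ℝ} (hh : Measurable h)
    (hg : Measurable g) (hhB : ∀ x : X, ∀ y ∈ Y, ℓ (h x) y ≤ B)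
    (hgB : ∀ x : X, ∀ y ∈ Y, ℓ (g x) y ≤ B) :
    risk ℓ D (mix α h g) ≤ 2 * α ^ 2 * risk ℓ D h + 2 * (1 - α) ^ 2 * risk ℓ D g := by
  have hint : ∀ f : X → ℝ, Measurable f → (∀ x : X, ∀ y ∈ Y, ℓ (f x) y ≤ B) →
      Integrable (fun ζ : X × Y => ℓ (f ζ.1) (ζ.2 : ℝ)) D := fun f hf hfB =>
    Integrable.of_bound (measurable_loss_comp hℓ hf).aestronglyMeasurable B
      (ae_of_all _ fun ζ => by
        rw [Real.norm_eq_abs, abs_of_nonneg (hℓ0 _ _)]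
        exact hfB ζ.1 ζ.2 ζ.2.2)
  have ih := (hint h hh hhB).const_mul (2 * α ^ 2)
  have ig := (hint g hg hgB).const_mul (2 * (1 - α) ^ 2)
  unfold risk
  rw [← integral_const_mul, ← integral_const_mul, ← integral_add ih ig]
  -- Only the upper function has to be integrable, so no bound on the loss of the mixture, which may
  -- lie outside the class, is needed.
  exact integral_mono_of_nonneg (ae_of_all _ fun ζ => hℓ0 _ _) (ih.add ig)
    (ae_of_all _ fun ζ => hmix _ _ _)

/-- The properties of the two losses that the risk bound uses. -/
theorem loss_properties {X : Type*} [Nonempty X] {Y : Set ℝ} (hYne : Y.Nonempty)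
    {ℓ : ℝ → ℝ → ℝ} (hℓ : (ℓ = sqHinge ∧ Y = {-1, 1}) ∨ ℓ = sqError) {H : Set (X → ℝ)} {B : ℝ}
    (hbd : ∀ h ∈ H, ∀ x : X, ∀ y ∈ Y, 0 ≤ ℓ (h x) y ∧ ℓ (h x) y ≤ B) :
    (Measurable fun p : ℝ × ℝ => ℓ p.1 p.2) ∧ (∀ u y, 0 ≤ ℓ u y) ∧
    (∀ α u w y : ℝ, 0 ≤ α → α ≤ 1 → ℓ (α * u + (1 - α) * w) y ≤
      2 * α ^ 2 * ℓ u y + 2 * (1 - α) ^ 2 * ℓ w y) ∧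
    (∀ h ∈ H, ∀ h' ∈ H, ∀ x : X, ∀ y ∈ Y,
      |ℓ (h x) y - ℓ (h' x) y| ≤ (2 * √B + 1) * |h x - h' x|) ∧
    ∃ c : ℝ, ∀ h ∈ H, ∀ x : X, c ≤ h x ∧ h x ≤ c + (2 * √B + 1) := by
  have hweak : ∀ t : ℝ, 2 * √B * |t| ≤ (2 * √B + 1) * |t| := fun t =>
    mul_le_mul_of_nonneg_right (by linarith) (abs_nonneg t)
  rcases hℓ with ⟨rfl, rfl⟩ | rfl
  · refine ⟨measurable_sqHinge, fun u y => sq_nonneg _, fun α u w y h0 h1 => sqHinge_mix_le h0 h1,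
      fun h hh h' hh' x y hy => ?_, -√B, fun h hh x => ?_⟩
    · refine (abs_sqHinge_sub_le ?_ (hbd h hh x y hy).2 (hbd h' hh' x y hy).2).trans (hweak _)
      rcases hy with rfl | rfl <;> simp
    · have := sqHinge_range (hbd h hh x 1 (by simp)).2 (hbd h hh x (-1) (by simp)).2
      exact ⟨this.1, by linarith⟩
  · obtain ⟨y, hy⟩ := hYne
    refine ⟨measurable_sqError, fun u y => sq_nonneg _, fun α u w y _ _ => sqError_mix_le,
      fun h hh h' hh' x y hy => (abs_sqError_sub_le (hbd h hh x y hy).2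
        (hbd h' hh' x y hy).2).trans (hweak _), y - √B, fun h hh x => ?_⟩
    have := sqError_range (hbd h hh x y hy).2
    exact ⟨this.1, by linarith⟩

/-- Sharing `δ` among three events adds $\log3\le2\le3d$ under the root, which a factor 4 absorbs.
This is where $d\ge1$ matters: the claim fails for $d=0$ and `δ` near 1. -/
theorem sqrt_confidence_split {d m δ : ℝ} (hd : 1 ≤ d) (hm : 0 ≤ m) (hδ0 : 0 < δ) (hδ1 : δ < 1) :
    √((d + Real.log (3 / δ)) / m) ≤ 2 * √((d + Real.log (1 / δ)) / m) := by
  have h3 : Real.log 3 ≤ 2 := by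
    have := Real.log_le_sub_one_of_pos (show (0 : ℝ) < 3 by norm_num)
    linarith
  have hlog : Real.log (3 / δ) = Real.log 3 + Real.log (1 / δ) := by
    rw [Real.log_div (by norm_num) hδ0.ne', Real.log_div one_ne_zero hδ0.ne', Real.log_one]; ring
  have hpos : 0 ≤ Real.log (1 / δ) := Real.log_nonneg (by rw [le_div_iff₀ hδ0]; linarith)
  have h4 : (2 : ℝ) * √((d + Real.log (1 / δ)) / m) = √(4 * ((d + Real.log (1 / δ)) / m)) := by
    rw [Real.sqrt_mul (by norm_num), show (4 : ℝ) = 2 ^ 2 by norm_num, Real.sqrt_sq (by norm_num)]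
  rw [h4, ← mul_div_assoc]
  refine Real.sqrt_le_sqrt (div_le_div_of_nonneg_right ?_ hm)
  rw [hlog]
  linarith

end FedMix

/-! ### The risk bound -/

/-- There are `n` clients; client `j` has the distribution `D j` on `X × Y` and `m j` data points.
`S` is the local data set of client `i`: `m i` i.i.d. points with law `D i`. `Z` is the global data
set: `m = ∑ j, m j` independent points drawn from the average distribution, in the sense that their
laws average to it. Nothing is assumed on the dependence between `Z` and `S`. So `Z` may be an
i.i.d. sample from the average distribution; and, when all `m j` are equal, `Z` may be the union of
the data sets of all the clients, `Z ⟨j, k⟩` with law `D j`, that of client `i` being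
`S k = Z ⟨i, k⟩`. `hbar` and `hloc` are the two training rules (jointly measurable in data and
input). The constant `C` depends on nothing but the bound `B` on the loss. -/
theorem theorem1 (B : ℝ) :
    ∃ C : ℝ, 0 < C ∧
      ∀ (X : Type u) [MeasurableSpace X] [StandardBorelSpace X] (Y : Set ℝ) (_ : MeasurableSet Y)
        -- the loss: squared hinge loss with labels ±1, or squared error
        (ℓ : ℝ → ℝ → ℝ)
        (_ : (ℓ = FedMix.sqHinge ∧ Y = {-1, 1}) ∨ ℓ = FedMix.sqError)
        -- the hypothesis class
        (H : Set (X → ℝ)) (_ : ∀ h ∈ H, Measurable h)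
        (d : ℕ) (_ : FedMix.vcDim H = d)
        -- boundedness and Lipschitz continuity of the loss on the class
        (_ : ∀ h ∈ H, ∀ x : X, ∀ y ∈ Y, 0 ≤ ℓ (h x) y ∧ ℓ (h x) y ≤ B)
        (G : ℝ) (_ : 0 ≤ G)
        (_ : ∀ h ∈ H, ∀ h' ∈ H, ∀ x : X, ∀ y ∈ Y, |ℓ (h x) y - ℓ (h' x) y| ≤ G * |h x - h' x|)
        -- clients and their distributions
        (n : ℕ) (D : Fin n → Measure (X × Y)) (_ : ∀ j, IsProbabilityMeasure (D j))
        (m : Fin n → ℕ) (i : Fin n) (_ : 0 < m i)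
        -- the data
        (Ω : Type v) [MeasurableSpace Ω] (μ : Measure Ω) [IsProbabilityMeasure μ]
        (Z : ((j : Fin n) × Fin (m j)) → Ω → X × Y) (_ : ∀ p, Measurable (Z p))
        (_ : iIndepFun Z μ)
        (_ : FedMix.avgDist (fun p => μ.map (Z p)) = FedMix.avgDist D)
        (S : Fin (m i) → Ω → X × Y) (_ : ∀ k, Measurable (S k))
        (_ : iIndepFun S μ) (_ : ∀ k, μ.map (S k) = D i)
        -- mixing weight and confidence
        (α : ℝ) (_ : 0 ≤ α) (_ : α ≤ 1) (δ : ℝ) (_ : 0 < δ) (_ : δ < 1)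
        -- global empirical risk minimizer
        (hbar : (((j : Fin n) × Fin (m j)) → X × Y) → X → ℝ)
        (_ : Measurable fun p : (((j : Fin n) × Fin (m j)) → X × Y) × X => hbar p.1 p.2)
        (_ : ∀ z, hbar z ∈ H ∧ IsMinOn (FedMix.empRisk ℓ z) H (hbar z))
        -- mixed local empirical risk minimizer
        (hloc : (((j : Fin n) × Fin (m j)) → X × Y) → (Fin (m i) → X × Y) → X → ℝ)
        (_ : Measurable fun p :
            ((((j : Fin n) × Fin (m j)) → X × Y) × (Fin (m i) → X × Y)) × X =>
              hloc p.1.1 p.1.2 p.2)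
        (_ : ∀ z s, hloc z s ∈ H ∧
          IsMinOn (fun h => FedMix.empRisk ℓ s (FedMix.mix α h (hbar z))) H (hloc z s))
        -- local true risk minimizer
        (hstar : X → ℝ) (_ : hstar ∈ H) (_ : IsMinOn (FedMix.risk ℓ (D i)) H hstar),
        let a : Ω → ℝ := fun ω =>
          FedMix.empRisk ℓ (fun p => Z p ω) (hbar fun p => Z p ω)
            + B * FedMix.l1Dist (FedMix.avgDist D) (D i)
            + C * √((d + Real.log (1 / δ)) / ((∑ j, m j : ℕ) : ℝ))
        let b : Ω → ℝ := fun ω =>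
          FedMix.risk ℓ (D i) hstar
            + 2 * C * √((d + Real.log (1 / δ)) / (m i : ℝ))
            + G * FedMix.disagreement H (fun k => S k ω)
        -- the risk bound, with probability at least 1 - δ
        (∃ E : Set Ω, MeasurableSet E ∧ ENNReal.ofReal (1 - δ) ≤ μ E ∧
          ∀ ω ∈ E,
            FedMix.risk ℓ (D i)
                (FedMix.mix α (hloc (fun p => Z p ω) (fun k => S k ω)) (hbar fun p => Z p ω))
              ≤ 2 * (1 - α) ^ 2 * a ω + 2 * α ^ 2 * b ω) ∧
        -- the weight that minimizes the right-hand side, strictly between 0 and 1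
        (∀ ω, a ω / (a ω + b ω) ∈ Set.Ioo (0 : ℝ) 1 ∧
          ∀ β : ℝ, β ≠ a ω / (a ω + b ω) →
            2 * (1 - a ω / (a ω + b ω)) ^ 2 * a ω + 2 * (a ω / (a ω + b ω)) ^ 2 * b ω
              < 2 * (1 - β) ^ 2 * a ω + 2 * β ^ 2 * b ω) := by
  -- One number bounds the width of the range of the class and the Lipschitz constant of the loss,
  -- both at most $2\sqrt B$, while $R^2\ge B$; the added 1 keeps it positive.
  set R : ℝ := 2 * √B + 1 with hRdef
  have hR : 0 < R := by positivity
  set K : ℝ := 2 * (20 + 80 * R ^ 4) + 1 with hK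
  have hK0 : 0 < K := by positivity
  -- `K` is the constant of the deviation bound; the factor 2 pays for replacing $\log(3/\delta)$ by
  -- $\log(1/\delta)$.
  refine ⟨2 * K, by positivity, ?_⟩
  intro X _ _ Y hY ℓ hℓ H hHm d hd hbd G hG hlipG n D hD m i hmi Ω _ μ _ Z hZ hZind hZavg S hS
    hSind hSD α hα0 hα1 δ hδ0 hδ1 hbar hbar_meas hbar_mem hloc hloc_meas hloc_mem hstar hstar_mem _
    a b
  have : StandardBorelSpace Y := hY.standardBorel
  obtain ⟨ζ₀⟩ : Nonempty (X × Y) := nonempty_of_isProbabilityMeasure (D i)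
  have : Nonempty (X × Y) := ⟨ζ₀⟩
  have : Nonempty X := ⟨ζ₀.1⟩
  have : Nonempty (Fin (m i)) := ⟨⟨0, hmi⟩⟩
  have : Nonempty ((j : Fin n) × Fin (m j)) := ⟨⟨i, ⟨0, hmi⟩⟩⟩
  have : Nonempty (Fin n) := ⟨i⟩
  obtain ⟨hℓm, hℓ0, hmix, hlip, c, hrange⟩ := FedMix.loss_properties ⟨_, ζ₀.2.2⟩ hℓ hbd
  rw [← hRdef] at hlip hrange
  have hB0 : 0 ≤ B := (hbd _ hstar_mem ζ₀.1 ζ₀.2 ζ₀.2.2).1.trans (hbd _ hstar_mem ζ₀.1 ζ₀.2 ζ₀.2.2).2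
  have hBR : B ≤ R ^ 2 := by
    rw [hRdef]; nlinarith [Real.sq_sqrt hB0, Real.sqrt_nonneg B]
  have hbdR : ∀ h ∈ H, ∀ x : X, ∀ y ∈ Y, 0 ≤ ℓ (h x) y ∧ ℓ (h x) y ≤ R ^ 2 :=
    fun h hh x y hy => ⟨(hbd h hh x y hy).1, (hbd h hh x y hy).2.trans hBR⟩
  have hbdB : ∀ h ∈ H, ∀ x : X, ∀ y ∈ Y, ℓ (h x) y ≤ B := fun h hh x y hy => (hbd h hh x y hy).2
  have hcard : Fintype.card ((j : Fin n) × Fin (m j)) = ∑ j, m j := by simp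
  have hm0 : 0 < ((∑ j, m j : ℕ) : ℝ) := by
    rw [← hcard]; exact_mod_cast Fintype.card_pos
  have hmi0 : (0 : ℝ) < m i := by exact_mod_cast hmi
  have hlogδ : 0 < Real.log (1 / δ) := Real.log_pos (by rw [lt_div_iff₀ hδ0]; linarith)
  have hfin := FedMix.isFiniteMeasure_avgDist D
  set sm := √((d + Real.log (1 / δ)) / ((∑ j, m j : ℕ) : ℝ)) with hsm
  set si := √((d + Real.log (1 / δ)) / (m i : ℝ)) with hsi
  have hsm0 : 0 < sm := Real.sqrt_pos.2 (by positivity)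
  have hsi0 : 0 < si := Real.sqrt_pos.2 (by positivity)
  have hl1 : 0 ≤ FedMix.l1Dist (FedMix.avgDist D) (D i) := integral_nonneg fun _ => abs_nonneg _
  have hdis : ∀ ω, 0 ≤ FedMix.disagreement H (fun k => S k ω) := fun ω =>
    Real.iSup_nonneg fun p => by positivity
  have ha0 : ∀ ω, 0 < a ω := fun ω => by
    have h1 : 0 ≤ FedMix.empRisk ℓ (fun p => Z p ω) (hbar fun p => Z p ω) :=
      mul_nonneg (by positivity) (Finset.sum_nonneg fun _ _ => hℓ0 _ _)
    have h2 := mul_nonneg hB0 hl1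
    have h3 : 0 < 2 * K * sm := by positivity
    simp only [a]
    linarith
  have hb0 : ∀ ω, 0 < b ω := fun ω => by
    have h1 : 0 ≤ FedMix.risk ℓ (D i) hstar := integral_nonneg fun _ => hℓ0 _ _
    have h2 := mul_nonneg hG (hdis ω)
    have h3 : 0 < 2 * (2 * K) * si := by positivity
    simp only [b]
    linarith
  refine ⟨?_, fun ω => FedMix.quadratic_weight_minimizer (ha0 ω) (hb0 ω)⟩
  have hcombine : ∀ ω,
      FedMix.risk ℓ (FedMix.avgDist D) (hbar fun p => Z p ω) ≤
        FedMix.empRisk ℓ (fun p => Z p ω) (hbar fun p => Z p ω) + 2 * K * sm →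
      FedMix.risk ℓ (D i) (hloc (fun p => Z p ω) (fun k => S k ω)) ≤ b ω →
      FedMix.risk ℓ (D i)
        (FedMix.mix α (hloc (fun p => Z p ω) (fun k => S k ω)) (hbar fun p => Z p ω))
        ≤ 2 * (1 - α) ^ 2 * a ω + 2 * α ^ 2 * b ω := by
    intro ω h1 h2
    have hz := (hbar_mem fun p => Z p ω).1
    have hs := (hloc_mem (fun p => Z p ω) (fun k => S k ω)).1
    have h3 := FedMix.risk_mix_le hℓm hℓ0 (fun u w y => hmix α u w y hα0 hα1) (D i)
      (hHm _ hs) (hHm _ hz) (hbdB _ hs) (hbdB _ hz)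
    have h4 : FedMix.risk ℓ (D i) (hbar fun p => Z p ω) ≤ a ω := by
      have := FedMix.integral_le_integral_add_l1Dist (FedMix.avgDist D) (D i)
        (FedMix.measurable_loss_comp hℓm (hHm _ hz)) (fun ζ => hℓ0 _ _)
        (fun ζ => hbdB _ hz ζ.1 ζ.2 ζ.2.2)
      unfold FedMix.risk at h1
      simp only [a]
      unfold FedMix.risk
      linarith
    have h5 := mul_le_mul_of_nonneg_left h4 (show 0 ≤ 2 * (1 - α) ^ 2 by positivity)
    have h6 := mul_le_mul_of_nonneg_left h2 (show 0 ≤ 2 * α ^ 2 by positivity)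
    linarith
  have hglobal : ∀ L : ℝ, 0 ≤ L → μ {ω | K * √((d + L) / ((∑ j, m j : ℕ) : ℝ)) <
      1 * (FedMix.risk ℓ (FedMix.avgDist D) (hbar fun p => Z p ω) -
        FedMix.empRisk ℓ (fun p => Z p ω) (hbar fun p => Z p ω))} ≤
      ENNReal.ofReal (Real.exp (-L)) := by
    intro L hL
    have h := FedMix.measure_risk_deviation_le hd.le hR hrange hℓm hbdR hlip μ Z hZ hZind
      (fun _ => ()) measurable_const (fun p => hbar p.1)
      (hbar_meas.comp (f := fun q : ((((j : Fin n) × Fin (m j)) → X × Y) × Unit) × X =>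
        (q.1.1, q.2)) (by fun_prop))
      (fun p => (hbar_mem p.1).1) (ε := 1) (by simp) hL
    rw [hZavg, hcard] at h
    exact h
  rcases Nat.eq_zero_or_pos d with hd0 | hdpos
  -- For $d=0$ the local model equals `hstar`, so only the global deviation is random and it
  -- receives all of `δ`.
  · have hsub : H.Subsingleton := FedMix.subsingleton_of_vcDim_eq_zero (by rw [hd, hd0]; simp)
    have hbad := hglobal (Real.log (1 / δ)) hlogδ.le
    rw [← Real.log_inv, one_div, inv_inv, Real.exp_log hδ0, ← one_div] at hbad
    obtain ⟨E, hE, hμE, hgood⟩ := FedMix.exists_measurableSet_of_measure_le μ hδ0.le hbad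
    refine ⟨E, hE, hμE, fun ω hω => hcombine ω ?_ ?_⟩
    · have h1 := hgood ω hω
      rw [Set.mem_ofPred_eq, not_lt] at h1
      have : 0 < K * sm := by positivity
      linarith
    · rw [hsub (hloc_mem (fun p => Z p ω) (fun k => S k ω)).1 hstar_mem]
      have h2 := mul_nonneg hG (hdis ω)
      have h3 : 0 < 2 * (2 * K) * si := by positivity
      simp only [b]
      linarith
  · have hd1 : (1 : ℝ) ≤ d := by exact_mod_cast hdpos
    have hL : 0 ≤ Real.log (3 / δ) := Real.log_nonneg (by rw [le_div_iff₀ hδ0]; linarith)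
    have hexpL : Real.exp (-Real.log (3 / δ)) = δ / 3 := by
      rw [← Real.log_inv, inv_div, Real.exp_log (by positivity)]
    have havgS : (FedMix.avgDist fun k => μ.map (S k)) = D i := by
      simp only [hSD, FedMix.avgDist_const]
    have hbad1 := hglobal _ hL
    -- The local model reads the global sample too, which enters here as auxiliary data. Together
    -- with the reverse deviation at `hstar`, this accounts for the $2C$ in `b`.
    have hbad2 := FedMix.measure_risk_deviation_le hd.le hR hrange hℓm hbdR hlip μ S hS hSind
      (fun ω p => Z p ω) (measurable_pi_lambda _ hZ) (fun p => hloc p.2 p.1)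
      (hloc_meas.comp (f := fun q : ((Fin (m i) → X × Y) × (((j : Fin n) × Fin (m j)) → X × Y)) × X
        => ((q.1.2, q.1.1), q.2)) (by fun_prop))
      (fun p => (hloc_mem p.2 p.1).1) (ε := 1) (by simp) hL
    have hbad3 := FedMix.measure_risk_deviation_le hd.le hR hrange hℓm hbdR hlip μ S hS hSind
      (fun _ => ()) measurable_const (fun _ => hstar)
      ((hHm _ hstar_mem).comp measurable_snd) (fun _ => hstar_mem) (ε := -1) (by simp) hL
    rw [hexpL] at hbad1 hbad2 hbad3
    rw [havgS, Fintype.card_fin] at hbad2 hbad3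
    have hbad := (measure_union_le _ _).trans (add_le_add hbad1 ((measure_union_le _ _).trans
      (add_le_add hbad2 hbad3)))
    rw [← ENNReal.ofReal_add (by positivity) (by positivity),
      ← ENNReal.ofReal_add (by positivity) (by positivity),
      show δ / 3 + (δ / 3 + δ / 3) = δ by ring] at hbad
    obtain ⟨E, hE, hμE, hgood⟩ := FedMix.exists_measurableSet_of_measure_le μ hδ0.le hbad
    have hsplit_m := mul_le_mul_of_nonneg_left
      (FedMix.sqrt_confidence_split hd1 hm0.le hδ0 hδ1) hK0.le
    have hsplit_i := mul_le_mul_of_nonneg_left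
      (FedMix.sqrt_confidence_split hd1 hmi0.le hδ0 hδ1) hK0.le
    rw [← hsm] at hsplit_m
    rw [← hsi] at hsplit_i
    refine ⟨E, hE, hμE, fun ω hω => ?_⟩
    have hnot := hgood ω hω
    simp only [Set.mem_union, not_or, Set.mem_ofPred_eq, not_lt] at hnot
    obtain ⟨g1, g2, g3⟩ := hnot
    refine hcombine ω (by linarith) ?_
    have g4 := FedMix.empRisk_le_add_disagreement hrange hG hlipG (fun k => S k ω)
      (hloc_mem (fun p => Z p ω) (fun k => S k ω)).1 hstar_mem
    simp only [b]
    linarith
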